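/- Conventions. A filtered graph $G=\{E_1,\ldots,E_m\}$ is a graph with oriented edges $E_1,\ldots,E_m$, filtered by the subgraphs $G_i$ generated by $E_1,\ldots,E_i$. Maps of graphs send vertices to vertices and edges to edge paths. A map $f:G\to G$ is upper triangular if it fixes every vertex and, for each $i$, $f(E_i)=E_iu_i$ for an edge loop $u_i$ in $G_{i-1}$ (the trivial loop if $i=1$). A nontrivial edge path has height $r$ if it crosses $E_r$ (in some direction) and no $E_s$ with $s>r$; a trivial path has height $0$. If $\delta$ is an edge path of height less than $r$ starting at the terminal vertex of $E_r$, sliding $E_r$ along $\delta$ replaces $E_r$ by an edge, again called $E_r$, with the same initial vertex and whose terminal vertex is the terminal vertex of $\delta$; the associated map from the old graph to the new one is the identity on vertices and on all other edges and sends $E_r$ to $E_r\overline{\delta}$. For upper triangular maps $f,g$ of $G$, a common Nielsen path is a reduced (possibly trivial) edge path $\rho$ such that $f(\rho)$ and $g(\rho)$ are both homotopic to $\rho$ relative to the endpoints. A common indivisible Nielsen path (INP) is a nontrivial common Nielsen path which is not the concatenation of two nontrivial common Nielsen paths. For a loop $\beta$, $\beta^{k}$ with $k<0$ means $\overline{\beta}^{\,|k|}$,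 and $\beta^0$ is the trivial path. Proposition. Let $f',g'$ be upper triangular maps on a filtered graph $G'$. Then there are a filtered graph $G=\{E_1,\ldots,E_m\}$ with as many edges as $G'$, upper triangular maps $f,g$ on $G$, and a homotopy equivalence $\tau:G'\to G$ which is a composite of finitely many sliding moves, such that $f\tau$ is freely homotopic to $\tau f'$ and $g\tau$ is freely homotopic to $\tau g'$. Moreover, for every $r\in\{1,\ldots,m\}$ such that $f,g$ have a common Nielsen path of height $r$, there exist integers $r_f,r_g$ (possibly zero) and a loop $\beta_r$ at the terminal vertex of $E_r$ which is a common Nielsen path of height at most $r-1$, such that the following hold. (i) $f(E_r)=E_r\beta_r^{r_f}$ and $g(E_r)=E_r\beta_r^{r_g}$, as edge paths. (ii) Up to powers (including inverses) there is a unique common INP of height $r$. Precisely: if $r_f=r_g=0$, then $E_r$ is a common INP, and every common INP of height $r$ is $E_r$ or $\overline{E_r}$. Otherwise $E_r\beta_r\overline{E_r}$ is a common INP, and every common INP of height $r$ is the path $E_r\beta_r^{k}\overline{E_r}$ for some integer $k\neq 0$. -/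

import Mathlib

universe u v w

/-- A graph with vertex set `V` and `m` geometric edges, filtered one edge at a time.
The edge with index `i : Fin m` comes with its preferred orientation, from `src i` to `tgt i`;
the `r`-th term of the filtration is the subgraph whose edges are those of index at most `r`
(indices start at `0`). -/
structure FilteredGraph (V : Type u) (m : ℕ) where
  src : Fin m → V
  tgt : Fin m → V

/-- A sequence of oriented edges: `(i, true)` is the edge `E_i` with its preferred orientation,
`(i, false)` is the reversed edge. The reverse of the sequence `α` is `FreeGroup.invRev α`, and
`FreeGroup.mk α = FreeGroup.mk β` says that `α` and `β` differ by insertions and deletions of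
backtracks, that is, of two adjacent mutually inverse oriented edges. -/
abbrev EdgeSeq (m : ℕ) : Type := List (Fin m × Bool)

namespace EdgeSeq

variable {m : ℕ}

/-- All edges of `α` have index less than `r`. A trivial path satisfies this for all `r`. -/
def Below (α : EdgeSeq m) (r : Fin m) : Prop := ∀ e ∈ α, e.1 < r

/-- `α` crosses the edge of index `r`, in some direction, and no edge of larger index. -/
def HasHeight (α : EdgeSeq m) (r : Fin m) : Prop := (∃ e ∈ α, e.1 = r) ∧ ∀ e ∈ α, e.1 ≤ r

/-- The `k`-th power of a loop, a negative power being a power of the reversed loop. No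
cancellation is carried out. -/
def zpow (α : EdgeSeq m) : ℤ → EdgeSeq m
  | Int.ofNat n => (List.replicate n α).flatten
  | Int.negSucc n => (List.replicate (n + 1) (FreeGroup.invRev α)).flatten

end EdgeSeq

namespace FilteredGraph

variable {V : Type u} {m : ℕ}

/-- Initial vertex of an oriented edge. -/
def initial (G : FilteredGraph V m) (e : Fin m × Bool) : V :=
  if e.2 then G.src e.1 else G.tgt e.1

/-- Terminal vertex of an oriented edge. -/
def terminal (G : FilteredGraph V m) (e : Fin m × Bool) : V :=
  if e.2 then G.tgt e.1 else G.src e.1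

/-- `G.IsPath a α b`: the sequence `α` is an edge path from `a` to `b`. The empty sequence is the
trivial path at any vertex. -/
def IsPath (G : FilteredGraph V m) : V → EdgeSeq m → V → Prop
  | a, [], b => a = b
  | a, e :: α, b => a = G.initial e ∧ G.IsPath (G.terminal e) α b

/-- `α` and `β` are edge paths from `a` to `b` that are homotopic relative to their endpoints. -/
def Homotopic (G : FilteredGraph V m) (a b : V) (α β : EdgeSeq m) : Prop :=
  G.IsPath a α b ∧ G.IsPath a β b ∧ FreeGroup.mk α = FreeGroup.mk β

theorem IsPath.append {G : FilteredGraph V m} {a b c : V} {α β : EdgeSeq m}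
    (hα : G.IsPath a α b) (hβ : G.IsPath b β c) : G.IsPath a (α ++ β) c := by
  induction α generalizing a with
  | nil => cases hα; exact hβ
  | cons e α ih => exact ⟨hα.1, ih hα.2⟩

theorem isPath_single (G : FilteredGraph V m) (e : Fin m × Bool) :
    G.IsPath (G.initial e) [e] (G.terminal e) := ⟨rfl, rfl⟩

theorem IsPath.invRev {G : FilteredGraph V m} {a b : V} {α : EdgeSeq m}
    (hα : G.IsPath a α b) : G.IsPath b (FreeGroup.invRev α) a := by
  induction α generalizing a with
  | nil => cases hα; rfl
  | cons e α ih =>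
    obtain ⟨rfl, h⟩ := hα
    have h1 : FreeGroup.invRev (e :: α) = FreeGroup.invRev α ++ [(e.1, !e.2)] := by
      simp [FreeGroup.invRev]
    rw [h1]
    refine (ih h).append ?_
    rcases e with ⟨i, _ | _⟩ <;> exact ⟨rfl, rfl⟩

end FilteredGraph

/-- A map of graphs that sends vertices to vertices and edges to edge paths. -/
structure GraphMap {V : Type u} {W : Type v} {m n : ℕ} (G : FilteredGraph V m)
    (H : FilteredGraph W n) where
  onVert : V → W
  onEdge : Fin m → EdgeSeq n
  isPath_onEdge : ∀ i, H.IsPath (onVert (G.src i)) (onEdge i) (onVert (G.tgt i))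

namespace GraphMap

variable {U : Type w} {V : Type u} {W : Type v} {l m n : ℕ}
  {F : FilteredGraph U l} {G : FilteredGraph V m} {H : FilteredGraph W n}

/-- The image of an edge path, without cancellation. -/
def onPath (p : GraphMap G H) (α : EdgeSeq m) : EdgeSeq n :=
  α.flatMap fun e => if e.2 then p.onEdge e.1 else FreeGroup.invRev (p.onEdge e.1)

theorem isPath_onPath (p : GraphMap G H) {a b : V} {α : EdgeSeq m} (hα : G.IsPath a α b) :
    H.IsPath (p.onVert a) (p.onPath α) (p.onVert b) := by
  induction α generalizing a with
  | nil => cases hα; rfl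
  | cons e α ih =>
    obtain ⟨rfl, h⟩ := hα
    have h1 : p.onPath (e :: α) =
        (if e.2 then p.onEdge e.1 else FreeGroup.invRev (p.onEdge e.1)) ++ p.onPath α := rfl
    rw [h1]
    refine FilteredGraph.IsPath.append ?_ (ih h)
    rcases e with ⟨i, _ | _⟩
    · exact (p.isPath_onEdge i).invRev
    · exact p.isPath_onEdge i

/-- The identity map. -/
def id (G : FilteredGraph V m) : GraphMap G G where
  onVert a := a
  onEdge i := [(i, true)]
  isPath_onEdge i := G.isPath_single (i, true)

/-- The composite `q ∘ p`. -/
def comp (q : GraphMap G H) (p : GraphMap F G) : GraphMap F H where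
  onVert a := q.onVert (p.onVert a)
  onEdge i := q.onPath (p.onEdge i)
  isPath_onEdge i := q.isPath_onPath (p.isPath_onEdge i)

/-- Free homotopy of graph maps: the homotopy moves each vertex `a` along an edge path `h a`, and
for each edge `E` from `a` to `b` the paths `p(E) (h b)` and `(h a) q(E)` are homotopic relative to
their endpoints. -/
def FreelyHomotopic (p q : GraphMap G H) : Prop :=
  ∃ h : V → EdgeSeq n, (∀ a, H.IsPath (p.onVert a) (h a) (q.onVert a)) ∧
    ∀ i, H.Homotopic (p.onVert (G.src i)) (q.onVert (G.tgt i))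
      (p.onEdge i ++ h (G.tgt i)) (h (G.src i) ++ q.onEdge i)

/-- `p` has a homotopy inverse. -/
def IsHomotopyEquiv (p : GraphMap G H) : Prop :=
  ∃ q : GraphMap H G, (q.comp p).FreelyHomotopic (GraphMap.id G) ∧
    (p.comp q).FreelyHomotopic (GraphMap.id H)

/-- `f` fixes all vertices and `f(E_i) = E_i u_i` for a loop `u_i` in the subgraph formed by the
edges of index less than `i`. -/
def IsUpperTriangular (f : GraphMap G G) : Prop :=
  (∀ a, f.onVert a = a) ∧
    ∀ i, ∃ u : EdgeSeq m, G.IsPath (G.tgt i) u (G.tgt i) ∧ u.Below i ∧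
      f.onEdge i = (i, true) :: u

/-- `ρ` is a common Nielsen path of `f` and `g`: a reduced edge path that both maps fix up to
homotopy relative to the endpoints. Trivial paths are allowed. -/
def IsCommonNielsen (f g : GraphMap G G) (ρ : EdgeSeq m) : Prop :=
  FreeGroup.IsReduced ρ ∧
    ∃ a b, G.Homotopic a b (f.onPath ρ) ρ ∧ G.Homotopic a b (g.onPath ρ) ρ

/-- `ρ` is a common indivisible Nielsen path of `f` and `g`: it is not trivial and is not the
concatenation of two nontrivial common Nielsen paths. -/
def IsCommonIndivisibleNielsen (f g : GraphMap G G) (ρ : EdgeSeq m) : Prop :=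
  IsCommonNielsen f g ρ ∧ ρ ≠ [] ∧
    ∀ α β : EdgeSeq m, ρ = α ++ β → IsCommonNielsen f g α → IsCommonNielsen f g β →
      α = [] ∨ β = []

end GraphMap

namespace FilteredGraph

variable {V : Type u} {m : ℕ}

/-- The graph obtained from `G` by moving the terminal end of the edge `E_r` to the vertex `c`. -/
def slide (G : FilteredGraph V m) (r : Fin m) (c : V) : FilteredGraph V m where
  src := G.src
  tgt := Function.update G.tgt r c

theorem IsPath.slide {G : FilteredGraph V m} {r : Fin m} (c : V) {a b : V} {α : EdgeSeq m}
    (hα : G.IsPath a α b) (hr : α.Below r) : (G.slide r c).IsPath a α b := by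
  induction α generalizing a with
  | nil => exact hα
  | cons e α ih =>
    have he : e.1 ≠ r := (hr e (by simp)).ne
    have h2 := ih hα.2 (fun x hx => hr x (by simp [hx]))
    have hi : (G.slide r c).initial e = G.initial e := by
      simp [initial, FilteredGraph.slide, Function.update_of_ne he]
    have ht : (G.slide r c).terminal e = G.terminal e := by
      simp [terminal, FilteredGraph.slide, Function.update_of_ne he]
    exact ⟨hi.symm ▸ hα.1, ht.symm ▸ h2⟩

/-- The map to the new graph when `E_r` is slid along a path `δ` which starts at the terminal vertex
of `E_r` and crosses edges of smaller index only: it sends the old edge `E_r` to `E_r` followed by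
the reverse of `δ` and is the identity on all vertices and all other edges. -/
def slideMap (G : FilteredGraph V m) (r : Fin m) (δ : EdgeSeq m) (c : V)
    (hδ : G.IsPath (G.tgt r) δ c) (hr : δ.Below r) : GraphMap G (G.slide r c) where
  onVert a := a
  onEdge i := if i = r then (r, true) :: FreeGroup.invRev δ else [(i, true)]
  isPath_onEdge i := by
    by_cases h : i = r
    · subst h
      simp only [if_true]
      refine ⟨rfl, ?_⟩
      have : (G.slide i c).terminal (i, true) = c := by simp [terminal, slide]
      rw [this]
      exact (hδ.slide c hr).invRev
    · simp only [if_neg h]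
      refine ⟨rfl, ?_⟩
      change (G.slide r c).tgt i = G.tgt i
      simp [slide, Function.update_of_ne h]

end FilteredGraph

/-- `τ` is a composite of finitely many sliding moves. -/
inductive IsSlideComposite {V : Type u} {m : ℕ} (G₀ : FilteredGraph V m) :
    (G : FilteredGraph V m) → GraphMap G₀ G → Prop
  | refl : IsSlideComposite G₀ G₀ (GraphMap.id G₀)
  | step (G : FilteredGraph V m) (τ : GraphMap G₀ G) (r : Fin m) (δ : EdgeSeq m) (c : V)
      (hδ : G.IsPath (G.tgt r) δ c) (hr : δ.Below r) :
      IsSlideComposite G₀ G τ →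
        IsSlideComposite G₀ (G.slide r c) ((G.slideMap r δ c hδ hr).comp τ)

/-! Edge paths with the same endpoints are homotopic exactly when they agree in the free group on
all edges. An upper triangular map therefore becomes a triangular endomorphism φ, with φ(e_i) = e_i
u_i and u_i a word in smaller letters, and Nielsen paths become fixed words. Injectivity of φ
ensures that letters of maximal index r in a reduced word survive in the reduced image
(`IsTriangular.toWord_map_split`), so the fixed point equation can be cut at every occurrence of
E_r.

Let x and y be the tails of E_r under f and g. Cutting a common Nielsen path of height r leaves two
possibilities (`exists_twisted_fixed`). Either some path σ below r, starting at the end of E_r,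
satisfies x f(σ) = σ and y g(σ) = σ; sliding E_r along σ then makes both tails trivial. Or there is
no such σ, and some nontrivial loop C below r satisfies x f(C) x⁻¹ = C and y g(C) y⁻¹ = C.

In the second case C or its inverse is conjugate, along a path δ, to a cyclically reduced loop κ
that starts with its top edge. Then f(κ) is conjugate to κ, and all iterates of κ are again
cyclically reduced conjugates of κ. They have bounded length, so κ is periodic. Periodic words are
fixed (`IsTriangular.map_eq_of_iterate_eq`): in a unitriangular rational representation the entries
of the n-th iterate are polynomial in n, and such representations separate the elements of a free
group. Hence f(κ) = κ, and after sliding along δ both tails commute with κ. Centralisers in free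
groups are cyclic, so the tails are powers β^a and β^b of the root β of κ.

The uniqueness of the INP also comes from this (`exists_root_of_twisted_fixed`). A further common
twisted fixed loop γ higher than β would contain an excluded path σ. Otherwise β^N γ β^N is, for
suitable N, cyclically reduced and starts with the top edge, so it commutes with β^a and β^b, which
are not both trivial; hence γ is a power of β.

Sliding E_r does not affect lower edges, so the edges are treated in increasing order. -/

namespace FreeGroup

/-! ### Reduced words, conjugation and centralisers in free groups. -/

variable {α : Type*}

theorem IsReduced.toWord_mk [DecidableEq α] {L : List (α × Bool)} (h : IsReduced L) :
    (mk L).toWord = L := by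
  rw [FreeGroup.toWord_mk, h.reduce_eq]

theorem IsReduced.left {L₁ L₂ : List (α × Bool)} (h : IsReduced (L₁ ++ L₂)) : IsReduced L₁ :=
  h.infix ⟨[], L₂, by simp⟩

theorem IsReduced.right {L₁ L₂ : List (α × Bool)} (h : IsReduced (L₁ ++ L₂)) : IsReduced L₂ :=
  h.infix ⟨L₁, [], by simp⟩

theorem IsReduced.eq_nil_of_mk_eq_one {L : List (α × Bool)} (h : IsReduced L) (h1 : mk L = 1) :
    L = [] := by
  classical
  rw [← h.toWord_mk, h1, toWord_one]

theorem IsReduced.mk_injective {L₁ L₂ : List (α × Bool)} (h₁ : IsReduced L₁) (h₂ : IsReduced L₂)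
    (h : mk L₁ = mk L₂) : L₁ = L₂ := by
  classical
  rw [← h₁.toWord_mk, h, h₂.toWord_mk]

theorem mk_append (L₁ L₂ : List (α × Bool)) : mk (L₁ ++ L₂) = mk L₁ * mk L₂ := mul_mk.symm

theorem mk_cons (e : α × Bool) (L : List (α × Bool)) : mk (e :: L) = mk [e] * mk L := by
  rw [mul_mk]; rfl

theorem mk_invRev (L : List (α × Bool)) : mk (invRev L) = (mk L)⁻¹ := inv_mk.symm

theorem mem_invRev {L : List (α × Bool)} {e : α × Bool} : e ∈ invRev L ↔ (e.1, !e.2) ∈ L := by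
  rcases e with ⟨i, b⟩
  simp only [invRev, List.mem_reverse, List.mem_map, Prod.mk.injEq, Prod.exists]
  constructor
  · rintro ⟨a, c, h, rfl, rfl⟩; simpa using h
  · intro h; exact ⟨i, !b, h, rfl, by simp⟩

theorem isReduced_invRev {L : List (α × Bool)} (h : IsReduced L) : IsReduced (invRev L) := by
  classical
  rw [isReduced_iff_reduce_eq] at h ⊢
  rw [reduce_invRev, h]

/-- The words with all letters in `S` form a subgroup. -/
def supported [DecidableEq α] (S : Set α) : Subgroup (FreeGroup α) where
  carrier := {w | ∀ e ∈ w.toWord, e.1 ∈ S}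
  one_mem' := by simp
  mul_mem' := by
    intro a b ha hb e he
    rcases List.mem_append.1 ((toWord_mul_sublist a b).subset he) with h | h
    · exact ha e h
    · exact hb e h
  inv_mem' := by
    intro a ha e he
    rw [toWord_inv, mem_invRev] at he
    exact ha (e.1, !e.2) he

theorem mk_mem_supported [DecidableEq α] {S : Set α} {L : List (α × Bool)}
    (h : ∀ e ∈ L, e.1 ∈ S) : mk L ∈ supported S := by
  intro e he
  rw [toWord_mk] at he
  exact h e (reduce.red.sublist.subset he)

theorem supported_mono [DecidableEq α] {S T : Set α} (h : S ⊆ T) : supported S ≤ supported T :=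
  fun _ hw e he => h (hw e he)

/-- A homomorphism maps elements supported in `S` to a subgroup if it does so for generators. -/
theorem map_mem_of_supported [DecidableEq α] {H : Type*} [Group H] (φ : FreeGroup α →* H)
    {S : Set α} {K : Subgroup H} (h : ∀ i ∈ S, φ (of i) ∈ K) {w : FreeGroup α}
    (hw : w ∈ supported S) : φ w ∈ K := by
  have key : ∀ L : List (α × Bool), (∀ e ∈ L, e.1 ∈ S) → φ (mk L) ∈ K := by
    intro L
    induction L with
    | nil => intro _; rw [← one_eq_mk, _root_.map_one]; exact K.one_mem
    | cons e L ih =>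
      intro hL
      rw [mk_cons, _root_.map_mul]
      refine K.mul_mem ?_ (ih fun x hx => hL x (by simp [hx]))
      have hi := h e.1 (hL e (by simp))
      rcases e with ⟨i, _ | _⟩
      · have : mk [(i, false)] = (of i)⁻¹ := by simp [of, inv_mk, FreeGroup.invRev]
        rw [this, _root_.map_inv]; exact K.inv_mem hi
      · exact hi
  rw [← mk_toWord (x := w)]
  exact key _ hw

/-- Maximal cancellation in a product of two reduced words. -/
theorem IsReduced.exists_cancel {L₁ L₂ : List (α × Bool)} (h₁ : IsReduced L₁)
    (h₂ : IsReduced L₂) :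
    ∃ X C Y, L₁ = X ++ C ∧ L₂ = invRev C ++ Y ∧ IsReduced (X ++ Y) := by
  induction L₁ using List.reverseRecOn generalizing L₂ with
  | nil => exact ⟨[], [], L₂, by simp, by simp, by simpa using h₂⟩
  | append_singleton L e ih =>
    cases L₂ with
    | nil => exact ⟨L ++ [e], [], [], by simp, by simp, by simpa using h₁⟩
    | cons x L₂ =>
      by_cases hx : e.1 = x.1 ∧ e.2 ≠ x.2
      · have h₂' : IsReduced L₂ := h₂.right (L₁ := [x])
        obtain ⟨X, C, Y, rfl, rfl, h⟩ := ih h₁.left h₂'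
        refine ⟨X, C ++ [e], Y, by simp, ?_, h⟩
        have : x = (e.1, !e.2) := by
          obtain ⟨i, b⟩ := e; obtain ⟨j, c⟩ := x
          obtain ⟨rfl, hb⟩ := hx
          cases b <;> cases c <;> simp_all
        subst this
        simp [FreeGroup.invRev]
      · refine ⟨L ++ [e], [], x :: L₂, by simp, by simp, ?_⟩
        have hx' : e.1 = x.1 → e.2 = x.2 := by tauto
        have : IsReduced ([e] ++ (x :: L₂)) := by
          rw [List.singleton_append, isReduced_cons_cons]
          exact ⟨hx', h₂⟩
        exact h₁.append_overlap this (by simp)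

/-- If the product is long, the first letter of a left factor survives. -/
theorem head?_toWord_mul [DecidableEq α] {x y : FreeGroup α} (h : y.norm < (x * y).norm + x.norm) :
    (x * y).toWord.head? = x.toWord.head? := by
  obtain ⟨X, C, Y, hx, hy, hr⟩ := (isReduced_toWord (x := x)).exists_cancel
    (isReduced_toWord (x := y))
  have hxy : (x * y).toWord = X ++ Y := by
    rw [← hr.toWord_mk]
    congr 1
    rw [← mk_toWord (x := x), ← mk_toWord (x := y), hx, hy]
    simp only [mk_append, mk_invRev]
    group
  cases X with
  | nil =>
    exfalso
    simp only [norm, hxy, hx, hy] at h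
    simp at h
    omega
  | cons a X => rw [hxy, hx]; rfl

theorem getLast?_toWord_mul [DecidableEq α] {x y : FreeGroup α}
    (h : x.norm < (x * y).norm + y.norm) :
    (x * y).toWord.getLast? = y.toWord.getLast? := by
  have h1 := head?_toWord_mul (x := y⁻¹) (y := x⁻¹) (by
    rw [← mul_inv_rev, norm_inv_eq, norm_inv_eq, norm_inv_eq]; exact h)
  rw [← mul_inv_rev] at h1
  simp only [toWord_inv, FreeGroup.invRev, List.head?_reverse, List.getLast?_map] at h1
  have hinj : Function.Injective (fun g : α × Bool => (g.1, !g.2)) := by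
    rintro ⟨a, b⟩ ⟨c, d⟩; simp
  exact Option.map_injective hinj h1

/-- The square of a cyclically reduced word is reduced and contains every cyclic rotation of the
word. -/
theorem isCyclicallyReduced_append_comm {L₁ L₂ : List (α × Bool)}
    (h : IsCyclicallyReduced (L₁ ++ L₂)) : IsCyclicallyReduced (L₂ ++ L₁) := by
  rcases eq_or_ne L₁ [] with rfl | h₁
  · simpa using h
  rcases eq_or_ne L₂ [] with rfl | h₂
  · simpa using h
  have h3 := (h.flatten_replicate 2).isReduced
  have h4 : IsReduced (L₂ ++ L₁) := h3.infix ⟨L₁, L₂, by simp⟩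
  refine ⟨h4, ?_⟩
  intro a ha b hb hab
  rw [List.getLast?_append_of_ne_nil _ h₁] at ha
  rw [List.head?_append_of_ne_nil _ h₂] at hb
  have h5 := h.isReduced
  rw [IsReduced, List.isChain_append] at h5
  exact h5.2.2 a ha b hb hab

theorem norm_pow_of_isCyclicallyReduced [DecidableEq α] {w : FreeGroup α}
    (h : IsCyclicallyReduced w.toWord) (n : ℕ) : (w ^ n).norm = n * w.norm := by
  rw [norm, toWord_pow, (h.flatten_replicate n).isReduced.reduce_eq]
  simp [norm]

/-- Powers of cyclically reduced words do not cancel, so n|w'| ≤ 2|g| + n|w| for every n; a large n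
gives the claim. By symmetry the two lengths agree. -/
theorem norm_le_of_conj [DecidableEq α] {w w' g : FreeGroup α}
    (h : IsCyclicallyReduced w.toWord) (h' : IsCyclicallyReduced w'.toWord)
    (hg : w' = g * w * g⁻¹) : w'.norm ≤ w.norm := by
  by_contra! hlt
  have h1 : ∀ n : ℕ, n * w'.norm ≤ 2 * g.norm + n * w.norm := by
    intro n
    rw [← norm_pow_of_isCyclicallyReduced h, ← norm_pow_of_isCyclicallyReduced h', hg, conj_pow]
    have := norm_mul_le (g * w ^ n) g⁻¹
    have := norm_mul_le g (w ^ n)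
    rw [norm_inv_eq] at *
    omega
  have h2 := h1 (2 * g.norm + 1)
  nlinarith

theorem finite_norm_le [DecidableEq α] [Finite α] (n : ℕ) :
    {w : FreeGroup α | w.norm ≤ n}.Finite := by
  have := (List.finite_length_le (α × Bool) n).preimage
    (f := (toWord : FreeGroup α → _)) toWord_injective.injOn
  exact this

/-- Roots in a free group are unique: y and its conjugate by x have the same n-th power. -/
theorem commute_of_pow_right {x y : FreeGroup α} {n : ℤ} (hn : n ≠ 0) (h : Commute x (y ^ n)) :
    Commute x y := by
  have h1 : (x * y * x⁻¹) ^ n = y ^ n := by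
    rw [conj_zpow, h.eq]; group
  have h2 := zpow_left_injective hn h1
  rw [commute_iff_eq]
  calc x * y = x * y * x⁻¹ * x := by group
    _ = y * x := by rw [h2]

/-- A free group with nontrivial centre is cyclic. -/
theorem subsingleton_of_central [DecidableEq α] {w : FreeGroup α} (hw : w ≠ 1)
    (h : ∀ x, Commute w x) : Subsingleton α := by
  constructor
  by_contra! hne
  -- With two generators available, some i differs from the first letter of w. Then i·w is reduced
  -- and starts with i, while the equal element w·i is longer than w and so starts like w.
  have key : ∃ (i : α), ∀ e ∈ w.toWord.head?, e.1 ≠ i := by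
    obtain ⟨i, j, hij⟩ := hne
    cases hh : w.toWord.head? with
    | none => exact ⟨i, by simp⟩
    | some e =>
      by_cases hi : e.1 = i
      · exact ⟨j, by simpa [hi] using hij⟩
      · exact ⟨i, by simpa using hi⟩
  obtain ⟨i, hi⟩ := key
  have hred : IsReduced ((i, true) :: w.toWord) := by
    cases hw' : w.toWord with
    | nil => simp
    | cons e L =>
      rw [isReduced_cons_cons, ← hw']
      refine ⟨fun h => absurd h.symm (hi e (by simp [hw'])), isReduced_toWord⟩
  have h1 : (of i * w).toWord = (i, true) :: w.toWord := by
    rw [← hred.toWord_mk, mk_cons, mk_toWord]; rfl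
  have h2 := head?_toWord_mul (x := w) (y := of i) (by
    rw [(h (of i)).eq]
    simp only [norm, h1, toWord_of, List.length_cons, List.length_nil]
    have : w.toWord ≠ [] := by rwa [Ne, toWord_eq_nil_iff]
    have := List.length_pos_iff.2 this
    omega)
  rw [(h (of i)).eq, h1] at h2
  exact hi (i, true) (by rw [← h2]; simp) rfl

/-- By Nielsen–Schreier the centraliser of w is free. It has w as a nontrivial central element, so
its rank is at most one. -/
theorem exists_centralizer_eq_zpowers {w : FreeGroup α} (hw : w ≠ 1) :
    ∃ b : FreeGroup α, ∀ x, Commute x w ↔ ∃ k : ℤ, x = b ^ k := by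
  classical
  let C := Subgroup.centralizer {w}
  have hwC : w ∈ C := by rw [Subgroup.mem_centralizer_singleton_iff]
  have memC : ∀ x, x ∈ C ↔ Commute x w := fun x => by
    rw [Subgroup.mem_centralizer_singleton_iff]; exact ⟨fun h => h, fun h => h⟩
  let e := IsFreeGroup.toFreeGroup C
  have hsub : Subsingleton (IsFreeGroup.Generators C) := by
    refine subsingleton_of_central (w := e ⟨w, hwC⟩) ?_ ?_
    · intro h
      rw [map_eq_one_iff e e.injective] at h
      exact hw (congrArg Subtype.val h)
    · intro x
      obtain ⟨y, rfl⟩ := e.surjective x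
      refine Commute.map ?_ e
      have := (memC _).1 y.2
      exact Subtype.ext this.eq.symm
  have hcyc : ∃ b : C, ∀ x : C, ∃ k : ℤ, b ^ k = x := by
    rcases isEmpty_or_nonempty (IsFreeGroup.Generators C) with hE | ⟨⟨i⟩⟩
    · exact ⟨1, fun x => ⟨0, e.injective (Subsingleton.elim _ _)⟩⟩
    · have : Unique (IsFreeGroup.Generators C) := ⟨⟨i⟩, fun _ => Subsingleton.elim _ _⟩
      obtain ⟨g, hg⟩ := IsCyclic.exists_generator (α := FreeGroup (IsFreeGroup.Generators C))
      refine ⟨e.symm g, fun x => ?_⟩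
      obtain ⟨k, hk⟩ := Subgroup.mem_zpowers_iff.1 (hg (e x))
      exact ⟨k, by rw [← map_zpow, hk]; simp⟩
  obtain ⟨b, hb⟩ := hcyc
  refine ⟨b, fun x => ⟨fun hx => ?_, ?_⟩⟩
  · obtain ⟨k, hk⟩ := hb ⟨x, (memC x).2 hx⟩
    exact ⟨k, by rw [← Subgroup.coe_zpow, hk]⟩
  · rintro ⟨k, rfl⟩
    exact ((memC _).1 b.2).zpow_left k

/-- Multiplying by a power of a nontrivial element on both sides makes words long. -/
theorem exists_norm_lt_pow_mul_pow [DecidableEq α] [Finite α] {b : FreeGroup α} (hb : b ≠ 1)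
    (g : FreeGroup α) (n : ℕ) : ∃ N : ℕ, n < (b ^ N * g * b ^ N).norm := by
  by_contra! hall
  -- Only finitely many words have bounded length, so two exponents give the same element and g =
  -- b^k g b^k for some k > 0. Conjugation by g then inverts b^k, so g² commutes with b^k, hence so
  -- does g, and b^(2k) = 1.
  obtain ⟨i, -, j, -, hij, h⟩ := (Set.infinite_univ (α := ℕ)).exists_ne_map_eq_of_mapsTo
    (f := fun N => b ^ N * g * b ^ N) (fun N _ => hall N) (finite_norm_le n)
  wlog hlt : i < j generalizing i j
  · exact this j i hij.symm h.symm (by omega)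
  obtain ⟨k, hk, rfl⟩ : ∃ k, k ≠ 0 ∧ j = i + k := ⟨j - i, by omega, by omega⟩
  have h1 : g = b ^ k * g * b ^ k := by
    have h' : b ^ i * g * b ^ i = b ^ i * (b ^ k * g * b ^ k) * b ^ i := by
      refine h.trans ?_
      rw [pow_add, (Commute.pow_pow_self b i k).eq]
      nth_rw 1 [← (Commute.pow_pow_self b i k).eq]
      simp only [mul_assoc]
    exact mul_left_cancel (mul_right_cancel h')
  have h2 : g⁻¹ * b ^ k * g = (b ^ k)⁻¹ := by
    rw [eq_inv_iff_mul_eq_one]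
    calc g⁻¹ * b ^ k * g * b ^ k = g⁻¹ * (b ^ k * g * b ^ k) := by group
      _ = 1 := by rw [← h1]; group
  have h3 : Commute (b ^ k) (g ^ (2 : ℤ)) := by
    have h4 : g⁻¹ * (g⁻¹ * b ^ k * g) * g = b ^ k := by
      rw [h2]
      calc g⁻¹ * (b ^ k)⁻¹ * g = (g⁻¹ * b ^ k * g)⁻¹ := by group
        _ = b ^ k := by rw [h2, inv_inv]
    rw [commute_iff_eq]
    have h5 : g ^ (2 : ℤ) = g * g := zpow_two g
    calc b ^ k * g ^ (2 : ℤ) = g * g * (g⁻¹ * (g⁻¹ * b ^ k * g) * g) := by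
          rw [h5]; simp only [mul_assoc, mul_inv_cancel_left]
      _ = g ^ (2 : ℤ) * b ^ k := by rw [h4, h5]
  have h5 := commute_of_pow_right (by norm_num) h3
  have h6 : (b ^ k) ^ 2 = 1 := by
    have : g⁻¹ * b ^ k * g = b ^ k := by rw [mul_assoc, h5.eq]; group
    rw [this] at h2
    rw [pow_two, ← eq_inv_iff_mul_eq_one]; exact h2
  rw [← pow_mul] at h6
  have := IsMulTorsionFree.pow_left_injective (M := FreeGroup α) (n := k * 2) (by omega)
    (a₁ := b) (a₂ := 1) (by simpa using h6)
  exact hb this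

end FreeGroup

/-! ### Polynomial sequences. -/

/-- A rational sequence given by a polynomial. -/
def IsPolySeq (a : ℕ → ℚ) : Prop := ∃ P : Polynomial ℚ, ∀ n : ℕ, a n = P.eval (n : ℚ)

namespace IsPolySeq

theorem const (c : ℚ) : IsPolySeq fun _ => c := ⟨Polynomial.C c, by simp⟩

theorem add {a b : ℕ → ℚ} (ha : IsPolySeq a) (hb : IsPolySeq b) :
    IsPolySeq fun n => a n + b n := by
  obtain ⟨P, hP⟩ := ha
  obtain ⟨Q, hQ⟩ := hb
  exact ⟨P + Q, fun n => by simp [hP, hQ]⟩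

theorem mul {a b : ℕ → ℚ} (ha : IsPolySeq a) (hb : IsPolySeq b) :
    IsPolySeq fun n => a n * b n := by
  obtain ⟨P, hP⟩ := ha
  obtain ⟨Q, hQ⟩ := hb
  exact ⟨P * Q, fun n => by simp [hP, hQ]⟩

theorem neg {a : ℕ → ℚ} (ha : IsPolySeq a) : IsPolySeq fun n => -a n := by
  obtain ⟨P, hP⟩ := ha
  exact ⟨-P, fun n => by simp [hP]⟩

theorem sum {ι : Type*} (s : Finset ι) {a : ι → ℕ → ℚ} (h : ∀ i ∈ s, IsPolySeq (a i)) :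
    IsPolySeq fun n => ∑ i ∈ s, a i n := by
  classical
  induction s using Finset.induction_on with
  | empty => simpa using const 0
  | insert i s hi ih =>
    simp only [Finset.sum_insert hi]
    exact (h i (by simp)).add (ih fun j hj => h j (by simp [hj]))

/-- This is Faulhaber's formula. -/
theorem sum_range_pow (p : ℕ) : IsPolySeq fun n => ∑ k ∈ Finset.range n, (k : ℚ) ^ p := by
  simp only [_root_.sum_range_pow]
  refine sum _ fun i _ => ⟨Polynomial.C (bernoulli i * ((p + 1).choose i) / (p + 1)) *
    Polynomial.X ^ (p + 1 - i), fun n => ?_⟩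
  simp
  ring

theorem sum_range {a : ℕ → ℚ} (ha : IsPolySeq a) :
    IsPolySeq fun n => ∑ k ∈ Finset.range n, a k := by
  obtain ⟨P, hP⟩ := ha
  have h : ∀ n, ∑ k ∈ Finset.range n, a k =
      ∑ i ∈ Finset.range (P.natDegree + 1), P.coeff i * ∑ k ∈ Finset.range n, (k : ℚ) ^ i := by
    intro n
    simp only [hP, Polynomial.eval_eq_sum_range, Finset.mul_sum]
    exact Finset.sum_comm
  simp only [h]
  exact sum _ fun i _ => (const _).mul (sum_range_pow i)

theorem of_sub {a b : ℕ → ℚ} (hb : IsPolySeq b) (h : ∀ n, a (n + 1) = a n + b n) :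
    IsPolySeq a := by
  have h1 : ∀ n, a n = a 0 + ∑ k ∈ Finset.range n, b k := by
    intro n
    induction n with
    | zero => simp
    | succ n ih => rw [h, ih, Finset.sum_range_succ, add_assoc]
  have := (const (a 0)).add hb.sum_range
  simpa only [← h1] using this

/-- The polynomial takes the value a 0 at the infinitely many points kn, hence is constant. -/
theorem eq_of_periodic {a : ℕ → ℚ} (ha : IsPolySeq a) {k : ℕ} (hk : 0 < k)
    (h : ∀ n, a (k * n) = a 0) (n : ℕ) : a n = a 0 := by
  obtain ⟨P, hP⟩ := ha
  have : P = Polynomial.C (a 0) := by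
    refine Polynomial.eq_of_infinite_eval_eq _ _ ?_
    refine Set.infinite_of_injective_forall_mem (f := fun n : ℕ => ((k * n : ℕ) : ℚ)) ?_ ?_
    · intro i j hij
      simpa [hk.ne'] using hij
    · intro n
      rw [Set.mem_ofPred_eq, ← hP, h]
      simp
  rw [hP, this]
  simp

end IsPolySeq

/-! ### Unitriangular matrices with polynomial entries. -/

namespace Matrix

variable {N : ℕ}

/-- Upper triangular with ones on the diagonal. -/
def IsUnitriangular (A : Matrix (Fin N) (Fin N) ℚ) : Prop :=
  (∀ p, A p p = 1) ∧ ∀ p q, q < p → A p q = 0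

theorem IsUnitriangular.one : IsUnitriangular (1 : Matrix (Fin N) (Fin N) ℚ) :=
  ⟨fun p => by simp, fun p q h => by simp [h.ne']⟩

theorem IsUnitriangular.mul {A B : Matrix (Fin N) (Fin N) ℚ} (hA : A.IsUnitriangular)
    (hB : B.IsUnitriangular) : (A * B).IsUnitriangular := by
  constructor
  · intro p
    rw [Matrix.mul_apply, Finset.sum_eq_single p]
    · rw [hA.1, hB.1, mul_one]
    · intro q _ hq
      rcases lt_or_gt_of_ne hq with h | h
      · rw [hA.2 _ _ h, zero_mul]
      · rw [hB.2 _ _ h, mul_zero]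
    · simp
  · intro p q hqp
    rw [Matrix.mul_apply]
    refine Finset.sum_eq_zero fun k _ => ?_
    rcases lt_or_ge k p with h | h
    · rw [hA.2 _ _ h, zero_mul]
    · rw [hB.2 _ _ (hqp.trans_le h), mul_zero]

/-- Every entry depends polynomially on the index. -/
def IsPolySeq (A : ℕ → Matrix (Fin N) (Fin N) ℚ) : Prop :=
  ∀ p q, _root_.IsPolySeq fun n => A n p q

theorem IsPolySeq.mul {A B : ℕ → Matrix (Fin N) (Fin N) ℚ} (hA : IsPolySeq A)
    (hB : IsPolySeq B) : IsPolySeq fun n => A n * B n := by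
  intro p q
  simp only [Matrix.mul_apply]
  exact _root_.IsPolySeq.sum _ fun k _ => (hA p k).mul (hB k q)

/-- Back substitution: B_pq = δ_pq − Σ_{k>p} A_pk B_kq expresses each row of B through the rows
below it. The induction parameter d counts rows from the bottom. -/
theorem IsPolySeq.of_mul_eq_one {A B : ℕ → Matrix (Fin N) (Fin N) ℚ} (hA : IsPolySeq A)
    (hu : ∀ n, (A n).IsUnitriangular) (h : ∀ n, A n * B n = 1) : IsPolySeq B := by
  suffices H : ∀ d : ℕ, ∀ p q : Fin N, N ≤ p.val + d → _root_.IsPolySeq fun n => B n p q from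
    fun p q => H N p q (by omega)
  intro d
  induction d with
  | zero => intro p q h; omega
  | succ d ih =>
    intro p q hpd
    have h1 : ∀ n, B n p q = (1 : Matrix (Fin N) (Fin N) ℚ) p q +
        -∑ k ∈ Finset.univ.filter (p < ·), A n p k * B n k q := by
      intro n
      rw [← h n, Matrix.mul_apply, ← Finset.sum_filter_add_sum_filter_not _ (p < ·)]
      have : ∑ k ∈ Finset.univ.filter (¬ p < ·), A n p k * B n k q = B n p q := by
        rw [Finset.sum_eq_single p]
        · rw [(hu n).1, one_mul]
        · intro k hk hkp
          rw [(hu n).2 p k (lt_of_le_of_ne (by simpa using hk) hkp), zero_mul]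
        · simp
      rw [this]; ring
    simp only [h1]
    refine (_root_.IsPolySeq.const _).add (_root_.IsPolySeq.neg ?_)
    refine _root_.IsPolySeq.sum _ fun k hk => (hA p k).mul (ih k q ?_)
    have : p < k := by simpa using hk
    have : p.val < k.val := this
    omega

/-- The difference W(n+1)_pq − W(n)_pq is Σ_{k<q} W(n)_pk A(n)_kq, which involves only columns left
of q. Summation of polynomial sequences then treats the columns from left to right. -/
theorem IsPolySeq.of_succ_eq_mul {A W : ℕ → Matrix (Fin N) (Fin N) ℚ} (hA : IsPolySeq A)
    (hu : ∀ n, (A n).IsUnitriangular) (h : ∀ n, W (n + 1) = W n * A n) : IsPolySeq W := by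
  suffices H : ∀ d : ℕ, ∀ p q : Fin N, q.val < d → _root_.IsPolySeq fun n => W n p q from
    fun p q => H N p q q.2
  intro d
  induction d with
  | zero => intro p q h; omega
  | succ d ih =>
    intro p q hqd
    refine _root_.IsPolySeq.of_sub (b := fun n => ∑ k ∈ Finset.univ.filter (· < q),
      W n p k * A n k q) ?_ ?_
    · refine _root_.IsPolySeq.sum _ fun k hk => (ih p k ?_).mul (hA k q)
      have : k < q := by simpa using hk
      have : k.val < q.val := this
      omega
    · intro n
      rw [h n, Matrix.mul_apply, ← Finset.sum_filter_add_sum_filter_not _ (· < q), add_comm]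
      congr 1
      rw [Finset.sum_eq_single q]
      · rw [(hu n).1, mul_one]
      · intro k hk hkq
        rw [(hu n).2 k q (lt_of_le_of_ne (by simpa using hk) (Ne.symm hkq)), mul_zero]
      · simp

end Matrix

/-! ### Triangular endomorphisms in unitriangular representations. -/

namespace FreeGroup

variable {α : Type*}

/-- A homomorphism to unitriangular rational matrices. -/
def IsUnitriangularRep {N : ℕ} (ρ : FreeGroup α →* (Matrix (Fin N) (Fin N) ℚ)ˣ) : Prop :=
  ∀ w, (ρ w : Matrix (Fin N) (Fin N) ℚ).IsUnitriangular

/-- Triangular endomorphisms of a free group with ordered generators: each generator is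
multiplied by a product of smaller ones. -/
def IsTriangular [LinearOrder α] (φ : FreeGroup α →* FreeGroup α) (u : α → FreeGroup α) : Prop :=
  ∀ i, φ (of i) = of i * u i ∧ u i ∈ supported (Set.Iio i)

theorem mem_of_supported [DecidableEq α] {S : Set α} {K : Subgroup (FreeGroup α)}
    (h : ∀ i ∈ S, of i ∈ K) {w : FreeGroup α} (hw : w ∈ supported S) : w ∈ K :=
  map_mem_of_supported (MonoidHom.id _) h hw

theorem of_mem_supported [DecidableEq α] {S : Set α} {i : α} (h : i ∈ S) : of i ∈ supported S :=
  mk_mem_supported (by simpa using h)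

/-- The elements w with this property form a subgroup. It contains each generator by induction on
the order, because φ^(n+1)(e_i) = φ^n(e_i) φ^n(u_i) is the recursion of
`Matrix.IsPolySeq.of_succ_eq_mul`. -/
theorem IsTriangular.isPolySeq_iterate [LinearOrder α] [WellFoundedLT α]
    {φ : FreeGroup α →* FreeGroup α}
    {u : α → FreeGroup α} (hφ : IsTriangular φ u) {N : ℕ}
    {ρ : FreeGroup α →* (Matrix (Fin N) (Fin N) ℚ)ˣ} (hρ : IsUnitriangularRep ρ)
    (w : FreeGroup α) : Matrix.IsPolySeq fun n => (ρ (φ^[n] w) : Matrix (Fin N) (Fin N) ℚ) := by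
  let K : Subgroup (FreeGroup α) :=
    { carrier := {w | Matrix.IsPolySeq fun n => (ρ (φ^[n] w) : Matrix (Fin N) (Fin N) ℚ)}
      one_mem' := fun p q => by
        simpa using IsPolySeq.const _
      mul_mem' := fun {a b} ha hb => by
        have : ∀ n, φ^[n] (a * b) = φ^[n] a * φ^[n] b := fun n => iterate_map_mul φ n a b
        simp only [Set.mem_ofPred_eq, this, _root_.map_mul, Units.val_mul] at *
        exact Matrix.IsPolySeq.mul ha hb
      inv_mem' := fun {a} ha => by
        refine Matrix.IsPolySeq.of_mul_eq_one ha (fun n => hρ _) fun n => ?_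
        rw [iterate_map_inv, _root_.map_inv, Units.mul_inv] }
  have key : ∀ i, of i ∈ K := by
    intro i
    induction i using WellFoundedLT.induction with
    | ind i ih =>
      have hu : u i ∈ K := mem_of_supported (S := Set.Iio i) (fun j hj => ih j hj) (hφ i).2
      refine Matrix.IsPolySeq.of_succ_eq_mul hu (fun n => hρ _) fun n => ?_
      rw [Function.iterate_succ_apply, (hφ i).1, iterate_map_mul, _root_.map_mul, Units.val_mul]
  exact mem_of_supported (S := Set.univ) (fun i _ => key i) (fun e _ => Set.mem_univ _)

end FreeGroup

/-! ### Magnus representations and periodic points. -/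

namespace FreeGroup

variable {α : Type*}

/-- Every element is a product of nontrivial powers of generators, consecutive ones distinct. -/
theorem exists_syllables [DecidableEq α] (w : FreeGroup α) : ∃ L : List (α × ℤ),
    L.IsChain (fun a b => a.1 ≠ b.1) ∧ (∀ a ∈ L, a.2 ≠ 0) ∧
      w = (L.map fun a => of a.1 ^ a.2).prod := by
  have step : ∀ (i : α) (e : ℤ) (w : FreeGroup α), e ≠ 0 → (∃ L : List (α × ℤ),
      L.IsChain (fun a b => a.1 ≠ b.1) ∧ (∀ a ∈ L, a.2 ≠ 0) ∧
        w = (L.map fun a => of a.1 ^ a.2).prod) → ∃ L : List (α × ℤ),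
      L.IsChain (fun a b => a.1 ≠ b.1) ∧ (∀ a ∈ L, a.2 ≠ 0) ∧
        of i ^ e * w = (L.map fun a => of a.1 ^ a.2).prod := by
    rintro i e _ he ⟨L, hc, h0, rfl⟩
    cases L with
    | nil => exact ⟨[(i, e)], by simp, by simpa using he, by simp⟩
    | cons x L =>
      by_cases hx : i = x.1
      · subst hx
        by_cases hs : e + x.2 = 0
        · refine ⟨L, hc.tail, fun a ha => h0 a (by simp [ha]), ?_⟩
          rw [List.map_cons, List.prod_cons, ← mul_assoc, ← zpow_add, hs, zpow_zero, one_mul]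
        · refine ⟨(x.1, e + x.2) :: L, ?_, ?_, ?_⟩
          · rw [List.isChain_cons] at hc ⊢
            exact hc
          · intro a ha
            rcases List.mem_cons.1 ha with rfl | ha
            · exact hs
            · exact h0 a (by simp [ha])
          · rw [List.map_cons, List.prod_cons, List.map_cons, List.prod_cons, ← mul_assoc,
              ← zpow_add]
      · refine ⟨(i, e) :: x :: L, ?_, ?_, by simp⟩
        · exact List.isChain_cons_cons.2 ⟨hx, hc⟩
        · intro a ha
          rcases List.mem_cons.1 ha with rfl | ha
          · exact he
          · exact h0 a ha
  rw [← mk_toWord (x := w)]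
  induction w.toWord with
  | nil => exact ⟨[], by simp, by simp, rfl⟩
  | cons e L ih =>
    rcases e with ⟨i, _ | _⟩
    · have := step i (-1) _ (by norm_num) ih
      rw [mk_cons]
      simpa [of, inv_mk, FreeGroup.invRev] using this
    · have := step i 1 _ (by norm_num) ih
      rw [mk_cons]
      simpa only [zpow_one, of] using this

/-- The strictly upper triangular matrix with ones at the places of the superdiagonal
labelled `i`. -/
def superdiag [DecidableEq α] (N : ℕ) (s : ℕ → α) (i : α) :
    Matrix (Fin (N + 1)) (Fin (N + 1)) ℚ :=
  fun p q => if p.val + 1 = q.val ∧ s p = i then 1 else 0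

theorem mul_superdiag_apply_eq_zero [DecidableEq α] {N : ℕ} {s : ℕ → α} {i : α}
    {A : Matrix (Fin (N + 1)) (Fin (N + 1)) ℚ} {p q : Fin (N + 1)}
    (h : ∀ k : Fin (N + 1), k.val + 1 = q.val → s k = i → A p k = 0) :
    (A * superdiag N s i) p q = 0 := by
  rw [Matrix.mul_apply]
  refine Finset.sum_eq_zero fun k _ => ?_
  simp only [superdiag]
  split_ifs with hk
  · rw [h k hk.1 hk.2, zero_mul]
  · rw [mul_zero]

theorem mul_superdiag_apply [DecidableEq α] {N : ℕ} {s : ℕ → α}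
    {A : Matrix (Fin (N + 1)) (Fin (N + 1)) ℚ} {p k q : Fin (N + 1)}
    (h : k.val + 1 = q.val) :
    (A * superdiag N s (s k)) p q = A p k := by
  rw [Matrix.mul_apply, Finset.sum_eq_single k]
  · simp [superdiag, h]
  · intro j _ hj
    have : ¬ (j.val + 1 = q.val) := fun h' => hj (Fin.ext (by omega))
    simp [superdiag, this]
  · simp

/-- A nonzero entry of the square would need two consecutive labels equal to i. Square zero is what
makes 1 − X inverse to 1 + X and gives (1 + X)^e = 1 + eX. -/
theorem superdiag_mul_self [DecidableEq α] {N : ℕ} {s : ℕ → α}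
    (hs : ∀ k, k + 1 < N → s k ≠ s (k + 1)) (i : α) :
    superdiag N s i * superdiag N s i = 0 := by
  ext p q
  refine mul_superdiag_apply_eq_zero fun k hk hki => ?_
  rw [superdiag, if_neg]
  rintro ⟨h1, h2⟩
  refine hs p (by omega) ?_
  rw [h1, h2, hki]

/-- The truncated Magnus representation along the sequence `s` of generators. -/
def magnusRep [DecidableEq α] (N : ℕ) (s : ℕ → α) (hs : ∀ k, k + 1 < N → s k ≠ s (k + 1)) :
    FreeGroup α →* (Matrix (Fin (N + 1)) (Fin (N + 1)) ℚ)ˣ :=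
  lift fun i =>
    { val := 1 + superdiag N s i
      inv := 1 - superdiag N s i
      val_inv := by
        have := superdiag_mul_self hs i
        rw [add_mul, mul_sub, mul_sub, this]; simp
      inv_val := by
        have := superdiag_mul_self hs i
        rw [sub_mul, mul_add, mul_add, this]; simp }

section magnusRep

variable [DecidableEq α] {N : ℕ} {s : ℕ → α} (hs : ∀ k, k + 1 < N → s k ≠ s (k + 1))

theorem magnusRep_of (i : α) :
    (magnusRep N s hs (of i) : Matrix (Fin (N + 1)) (Fin (N + 1)) ℚ) = 1 + superdiag N s i := by
  simp [magnusRep]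

theorem magnusRep_of_inv (i : α) :
    (magnusRep N s hs (of i)⁻¹ : Matrix (Fin (N + 1)) (Fin (N + 1)) ℚ) =
      1 - superdiag N s i := by
  rw [_root_.map_inv]
  simp only [magnusRep, lift_apply_of]
  rfl

theorem magnusRep_of_zpow (i : α) (e : ℤ) :
    (magnusRep N s hs (of i ^ e) : Matrix (Fin (N + 1)) (Fin (N + 1)) ℚ) =
      1 + (e : ℚ) • superdiag N s i := by
  have h0 := superdiag_mul_self hs i
  induction e using Int.induction_on with
  | zero => simp
  | succ n ih =>
    rw [zpow_add, zpow_one, _root_.map_mul, Units.val_mul, ih, magnusRep_of]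
    rw [mul_add, add_mul 1 _ (superdiag N s i), smul_mul_assoc, h0]
    push_cast
    rw [add_smul]
    simp [add_assoc]
  | pred n ih =>
    rw [sub_eq_add_neg, zpow_add, zpow_neg_one, _root_.map_mul, Units.val_mul, ih,
      magnusRep_of_inv]
    rw [mul_sub, add_mul 1 _ (superdiag N s i), smul_mul_assoc, h0]
    push_cast
    rw [add_smul]
    simp [sub_eq_add_neg, add_assoc]

theorem isUnitriangular_one_add_smul_superdiag (i : α) (c : ℚ) :
    (1 + c • superdiag N s i).IsUnitriangular := by
  constructor
  · intro p
    simp [superdiag]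
  · intro p q hqp
    have : ¬ (p.val + 1 = q.val) := by
      have : q.val < p.val := hqp
      omega
    simp [superdiag, this, hqp.ne']

theorem isUnitriangularRep_magnusRep : IsUnitriangularRep (magnusRep N s hs) := by
  intro w
  obtain ⟨L, -, -, rfl⟩ := exists_syllables w
  induction L with
  | nil => simpa using Matrix.IsUnitriangular.one
  | cons a L ih =>
    rw [List.map_cons, List.prod_cons, _root_.map_mul, Units.val_mul, magnusRep_of_zpow]
    exact (isUnitriangular_one_add_smul_superdiag _ _).mul ih

end magnusRep

/-- If the superdiagonal is labelled by the successive syllables of w, the top right entry of the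
image of w is the product of all syllable exponents. -/
theorem exists_magnusRep_ne_one [DecidableEq α] {w : FreeGroup α} (hw : w ≠ 1) :
    ∃ (N : ℕ) (ρ : FreeGroup α →* (Matrix (Fin N) (Fin N) ℚ)ˣ),
      IsUnitriangularRep ρ ∧ ρ w ≠ 1 := by
  obtain ⟨L, hc, h0, rfl⟩ := exists_syllables w
  have hL : L ≠ [] := by rintro rfl; simp at hw
  obtain ⟨x, hx⟩ := List.exists_mem_of_ne_nil L hL
  -- The default `x` plays no role: the superdiagonal has only `L.length` places.
  let s : ℕ → α := fun k => (L.getD k x).1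
  have hsL : ∀ k (hk : k < L.length), s k = L[k].1 := fun k hk => by
    simp [s, hk]
  have hs : ∀ k, k + 1 < L.length → s k ≠ s (k + 1) := by
    intro k hk
    rw [hsL k (by omega), hsL (k + 1) hk]
    exact List.isChain_iff_getElem.1 hc k hk
  refine ⟨L.length + 1, magnusRep L.length s hs, isUnitriangularRep_magnusRep hs, ?_⟩
  -- In the image of the first k syllables, row 0 has its last nonzero entry exactly in column k.
  have key : ∀ k, k ≤ L.length →
      (∀ q : Fin (L.length + 1), k < q.val →
        (magnusRep L.length s hs (((L.take k).map fun a => of a.1 ^ a.2).prod) :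
          Matrix (Fin (L.length + 1)) (Fin (L.length + 1)) ℚ) 0 q = 0) ∧
      (∀ q : Fin (L.length + 1), k = q.val →
        (magnusRep L.length s hs (((L.take k).map fun a => of a.1 ^ a.2).prod) :
          Matrix (Fin (L.length + 1)) (Fin (L.length + 1)) ℚ) 0 q ≠ 0) := by
    intro k
    induction k with
    | zero =>
      intro _
      constructor
      · intro q hq
        have : q ≠ 0 := by rintro rfl; simp at hq
        simp [this.symm]
      · intro q hq
        have : q = 0 := Fin.ext hq.symm
        simp [this]
    | succ k ih =>
      intro hk
      obtain ⟨ih1, ih2⟩ := ih (by omega)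
      have hk' : k < L.length := hk
      have e1 : ((L.take (k + 1)).map fun a => of a.1 ^ a.2).prod =
          ((L.take k).map fun a => of a.1 ^ a.2).prod * of L[k].1 ^ L[k].2 := by
        rw [List.take_succ_eq_append_getElem hk', List.map_append, List.prod_append,
          List.map_singleton, List.prod_singleton]
      rw [e1, _root_.map_mul, Units.val_mul, magnusRep_of_zpow]
      simp only [mul_add, mul_one, Matrix.mul_smul, Matrix.add_apply, Matrix.smul_apply]
      constructor
      · intro q hq
        rw [ih1 q (by omega), mul_superdiag_apply_eq_zero, smul_zero, add_zero]
        intro j hj _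
        exact ih1 j (by omega)
      · intro q hq
        rw [ih1 q (by omega), zero_add, ← hsL k hk']
        have := mul_superdiag_apply (s := s) (A := (magnusRep L.length s hs
          (((L.take k).map fun a => of a.1 ^ a.2).prod) :
            Matrix (Fin (L.length + 1)) (Fin (L.length + 1)) ℚ)) (p := 0)
            (k := ⟨k, by omega⟩) (q := q) hq
        simp only at this
        rw [this]
        refine smul_ne_zero ?_ (ih2 _ rfl)
        exact_mod_cast h0 _ (List.getElem_mem hk')
  intro h1
  have h2 := (key L.length le_rfl).2 (Fin.last _) rfl
  rw [List.take_length, h1] at h2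
  refine h2 ?_
  have : (0 : Fin (L.length + 1)) ≠ Fin.last _ := by
    intro h
    have := congrArg Fin.val h
    exact hL (List.length_eq_zero_iff.1 this.symm)
  simp [this]

/-- Periodic points of a triangular endomorphism are fixed points. -/
theorem IsTriangular.map_eq_of_iterate_eq [LinearOrder α] [WellFoundedLT α]
    {φ : FreeGroup α →* FreeGroup α} {u : α → FreeGroup α} (hφ : IsTriangular φ u)
    {w : FreeGroup α} {k : ℕ} (hk : 0 < k) (h : φ^[k] w = w) : φ w = w := by
  by_contra hne
  -- A representation that separates φ w from w contradicts the fact that the entries of ρ(φ^n w)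
  -- are polynomial in n and take their initial value at every multiple of k.
  obtain ⟨N, ρ, hρ, h1⟩ := exists_magnusRep_ne_one (w := φ w * w⁻¹) (by
    rwa [Ne, mul_inv_eq_one])
  refine h1 ?_
  rw [_root_.map_mul, _root_.map_inv, mul_inv_eq_one]
  refine Units.ext (Matrix.ext fun p q => ?_)
  have h2 := (hφ.isPolySeq_iterate hρ w p q).eq_of_periodic hk (fun n => ?_) 1
  · simpa using h2
  · simp only [Function.iterate_mul, Function.iterate_fixed h, Function.iterate_zero, id]

end FreeGroup

/-! ### Splitting words and their images at the top letter. -/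

namespace FreeGroup

variable {α : Type*}

/-- Split a word at its first letter of index `r`. -/
theorem exists_split_first [LinearOrder α] {r : α} {L : List (α × Bool)} (hle : ∀ e ∈ L, e.1 ≤ r)
    (h : ∃ e ∈ L, e.1 = r) :
    ∃ A e B, L = A ++ e :: B ∧ (∀ x ∈ A, x.1 < r) ∧ e.1 = r := by
  induction L with
  | nil => simp at h
  | cons x L ih =>
    by_cases hx : x.1 = r
    · exact ⟨[], x, L, rfl, by simp, hx⟩
    · obtain ⟨e, he, her⟩ := h
      have he' : e ∈ L := by
        rcases List.mem_cons.1 he with rfl | h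
        · exact absurd her hx
        · exact h
      obtain ⟨A, e', B, rfl, hA, he'⟩ := ih (fun y hy => hle y (by simp [hy])) ⟨e, he', her⟩
      refine ⟨x :: A, e', B, rfl, ?_, he'⟩
      intro y hy
      rcases List.mem_cons.1 hy with rfl | hy
      · exact lt_of_le_of_ne (hle _ (by simp)) hx
      · exact hA y hy

theorem exists_max_letter [LinearOrder α] {L : List (α × Bool)} (h : L ≠ []) :
    ∃ r, (∃ e ∈ L, e.1 = r) ∧ ∀ e ∈ L, e.1 ≤ r := by
  induction L with
  | nil => exact absurd rfl h
  | cons x L ih =>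
    rcases eq_or_ne L [] with rfl | hL
    · exact ⟨x.1, ⟨x, by simp⟩, by simp⟩
    · obtain ⟨r, ⟨e, he, her⟩, hr⟩ := ih hL
      rcases le_total x.1 r with hx | hx
      · refine ⟨r, ⟨e, by simp [he], her⟩, ?_⟩
        intro y hy
        rcases List.mem_cons.1 hy with rfl | hy
        · exact hx
        · exact hr y hy
      · refine ⟨x.1, ⟨x, by simp, rfl⟩, ?_⟩
        intro y hy
        rcases List.mem_cons.1 hy with rfl | hy
        · exact le_rfl
        · exact (hr y hy).trans hx

theorem lt_or_exists_eq [LinearOrder α] {r : α} {L : List (α × Bool)} (hle : ∀ e ∈ L, e.1 ≤ r) :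
    (∀ e ∈ L, e.1 < r) ∨ ∃ e ∈ L, e.1 = r := by
  by_cases h : ∃ e ∈ L, e.1 = r
  · exact Or.inr h
  · push Not at h
    exact Or.inl fun e he => lt_of_le_of_ne (hle e he) (h e he)

theorem isReduced_append_cons {X Y : List (α × Bool)} {e : α × Bool} (hX : IsReduced X)
    (hY : IsReduced (e :: Y)) (hne : ∀ x ∈ X, x.1 ≠ e.1) : IsReduced (X ++ e :: Y) := by
  rw [IsReduced, List.isChain_append]
  refine ⟨hX, hY, ?_⟩
  intro a ha b hb hab
  simp only [List.head?_cons, Option.mem_def, Option.some.injEq] at hb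
  subst hb
  exact absurd hab (hne a (List.mem_of_getLast? ha))

/-- The part of the image of the letter `e` before the letter itself, where the image of the
generator is the generator followed by `u`. -/
def preTail (u : FreeGroup α) (e : α × Bool) : FreeGroup α := if e.2 then 1 else u⁻¹

/-- The part of the image of the letter `e` after the letter itself. -/
def postTail (u : FreeGroup α) (e : α × Bool) : FreeGroup α := if e.2 then u else 1

theorem preTail_mem {K : Subgroup (FreeGroup α)} {x : FreeGroup α} (h : x ∈ K) (e : α × Bool) :
    preTail x e ∈ K := by
  unfold preTail
  split_ifs
  · exact K.one_mem
  · exact K.inv_mem h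

theorem postTail_mem {K : Subgroup (FreeGroup α)} {x : FreeGroup α} (h : x ∈ K)
    (e : α × Bool) : postTail x e ∈ K := by
  unfold postTail
  split_ifs
  · exact h
  · exact K.one_mem

section

variable [LinearOrder α] {φ : FreeGroup α →* FreeGroup α} {u : α → FreeGroup α}

theorem IsTriangular.map_letter (hφ : IsTriangular φ u) (e : α × Bool) :
    φ (mk [e]) = preTail (u e.1) e * mk [e] * postTail (u e.1) e := by
  rcases e with ⟨i, _ | _⟩
  · have : mk [(i, false)] = (of i)⁻¹ := by simp [of, inv_mk, FreeGroup.invRev]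
    rw [this, _root_.map_inv, (hφ i).1]
    simp [preTail, postTail]
  · have := (hφ i).1
    simp only [of] at this
    simp [preTail, postTail, this]

theorem IsTriangular.map_mem_Iio (hφ : IsTriangular φ u) {r : α} {w : FreeGroup α}
    (hw : w ∈ supported (Set.Iio r)) : φ w ∈ supported (Set.Iio r) := by
  refine map_mem_of_supported φ (fun i hi => ?_) hw
  rw [(hφ i).1]
  exact (supported _).mul_mem (of_mem_supported hi)
    (supported_mono (Set.Iio_subset_Iio (le_of_lt hi)) (hφ i).2)

theorem IsTriangular.map_mem_Iic (hφ : IsTriangular φ u) {r : α} {w : FreeGroup α}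
    (hw : w ∈ supported (Set.Iic r)) : φ w ∈ supported (Set.Iic r) := by
  refine map_mem_of_supported φ (fun i hi => ?_) hw
  rw [(hφ i).1]
  refine (supported _).mul_mem (of_mem_supported hi) (supported_mono ?_ (hφ i).2)
  intro j hj
  exact le_of_lt (lt_of_lt_of_le hj hi)

/-- The reduced form of the image of a word, split at its first letter of maximal index. -/
theorem IsTriangular.toWord_map_split_aux (hφ : IsTriangular φ u) {r : α}
    (hinj : ∀ w ∈ supported (Set.Iio r), φ w = 1 → w = 1) (n : ℕ)
    {A B : List (α × Bool)} {e : α × Bool} (hn : B.length < n) (hred : IsReduced (A ++ e :: B))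
    (hle : ∀ x ∈ A ++ e :: B, x.1 ≤ r) (hA : ∀ x ∈ A, x.1 < r) (he : e.1 = r)
    {c d : FreeGroup α} (hc : c ∈ supported (Set.Iio r)) (hd : d ∈ supported (Set.Iio r)) :
    (c * φ (mk (A ++ e :: B)) * d).toWord = (c * φ (mk A) * preTail (u r) e).toWord ++
      e :: (postTail (u r) e * φ (mk B) * d).toWord := by
  -- The left factor `c` must vary: for the tail `B` it becomes `postTail (u r) e`.
  induction n generalizing A B e c with
  | zero => omega
  | succ n ih =>
    have hX : c * φ (mk A) * preTail (u r) e ∈ supported (Set.Iio r) :=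
      (supported _).mul_mem ((supported _).mul_mem hc (hφ.map_mem_Iio (mk_mem_supported hA)))
        (preTail_mem (hφ r).2 e)
    have hpost : postTail (u r) e ∈ supported (Set.Iio r) := postTail_mem (hφ r).2 e
    have hBr : IsReduced B := IsReduced.right (L₁ := A ++ [e]) (by simpa using hred)
    have hY : IsReduced (e :: (postTail (u r) e * φ (mk B) * d).toWord) := by
      rcases lt_or_exists_eq (r := r) (L := B) (fun x hx => hle x (by simp [hx])) with hB | hB
      · have hmem : postTail (u r) e * φ (mk B) * d ∈ supported (Set.Iio r) :=
          (supported _).mul_mem ((supported _).mul_mem hpost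
            (hφ.map_mem_Iio (mk_mem_supported hB))) hd
        rw [IsReduced, List.isChain_cons]
        refine ⟨fun y hy hye => ?_, isReduced_toWord⟩
        have := hmem y (List.mem_of_head? hy)
        exact absurd (hye.symm.trans he) (ne_of_lt this)
      · obtain ⟨A₂, e₂, B₂, rfl, hA₂, he₂⟩ :=
          exists_split_first (fun x hx => hle x (by simp [hx])) hB
        have h2 := ih (A := A₂) (B := B₂) (e := e₂) (by simp at hn; omega) hBr
          (fun x hx => hle x (by simp at hx ⊢; tauto)) hA₂ he₂ hpost
        rw [h2, IsReduced, List.isChain_cons, ← h2]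
        refine ⟨?_, isReduced_toWord⟩
        rw [h2]
        have hX₂ : postTail (u r) e * φ (mk A₂) * preTail (u r) e₂ ∈ supported (Set.Iio r) :=
          (supported _).mul_mem ((supported _).mul_mem hpost
            (hφ.map_mem_Iio (mk_mem_supported hA₂))) (preTail_mem (hφ r).2 e₂)
        intro y hy hye
        cases hW : (postTail (u r) e * φ (mk A₂) * preTail (u r) e₂).toWord with
        | cons z Z =>
          rw [hW] at hy
          simp only [List.cons_append, List.head?_cons, Option.mem_def, Option.some.injEq] at hy
          subst hy
          have := hX₂ z (by rw [hW]; simp)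
          exact absurd (hye.symm.trans he) (ne_of_lt this)
        | nil =>
          rw [hW] at hy
          simp only [List.nil_append, List.head?_cons, Option.mem_def, Option.some.injEq] at hy
          subst hy
          -- The only danger is that everything between two consecutive top letters `e` and `e₂`
          -- disappears and these cancel. For opposite orientations the tails around φ(A₂) are
          -- trivial or conjugate it, so φ(A₂) = 1 and A₂ is empty; then the original word was not
          -- reduced.
          by_contra hne
          have h3 : postTail (u r) e * φ (mk A₂) * preTail (u r) e₂ = 1 :=
            toWord_eq_nil_iff.1 hW
          have h4 : φ (mk A₂) = 1 := by
            unfold postTail preTail at h3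
            rcases e with ⟨i, _ | _⟩ <;> rcases e₂ with ⟨j, _ | _⟩
            · exact absurd rfl hne
            · simpa using h3
            · simp only [if_true] at h3
              simpa [conj_eq_one_iff] using h3
            · exact absurd rfl hne
          have h5 : A₂ = [] := hBr.left.eq_nil_of_mk_eq_one
            (hinj _ (mk_mem_supported hA₂) h4)
          subst h5
          have h6 : IsReduced (e :: e₂ :: B₂) := IsReduced.right (L₁ := A) (by simpa using hred)
          exact hne ((isReduced_cons_cons.1 h6).1 (he.trans he₂.symm))
    have hXY := isReduced_append_cons (isReduced_toWord (x := c * φ (mk A) * preTail (u r) e)) hY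
      (fun x hx => by rw [he]; exact ne_of_lt (hX x hx))
    rw [← hXY.toWord_mk]
    congr 1
    have hsplit : ∀ (X Y : List (α × Bool)), mk (X ++ e :: Y) = mk X * mk [e] * mk Y := by
      intro X Y
      rw [mk_append, mk_cons, mul_assoc]
    rw [hsplit, hsplit, _root_.map_mul, _root_.map_mul, hφ.map_letter, mk_toWord, mk_toWord, he]
    simp only [mul_assoc]

/-- The top letter q < r of a nontrivial w survives in φ w. The splitting used for this needs
injectivity only below q, which the induction supplies. -/
theorem IsTriangular.eq_one_of_map_eq_one_of_supported [WellFoundedLT α] (hφ : IsTriangular φ u)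
    (r : α) : ∀ w ∈ supported (Set.Iio r), φ w = 1 → w = 1 := by
  induction r using WellFoundedLT.induction with
  | ind r ih =>
    intro w hw h1
    by_contra hne
    have hw' : w.toWord ≠ [] := by rwa [Ne, toWord_eq_nil_iff]
    obtain ⟨q, hq, hle⟩ := exists_max_letter hw'
    have hqr : q < r := by
      obtain ⟨e, he, rfl⟩ := hq
      exact hw e he
    obtain ⟨A, e, B, hAB, hA, he⟩ := exists_split_first hle hq
    have hred := isReduced_toWord (x := w)
    rw [hAB] at hred hle
    have h2 := hφ.toWord_map_split_aux (ih q hqr) (B.length + 1) (by omega) hred hle hA he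
      (supported _).one_mem (supported _).one_mem
    rw [← hAB, mk_toWord, h1] at h2
    simp at h2

theorem IsTriangular.injective [WellFoundedLT α] (hφ : IsTriangular φ u) :
    Function.Injective φ := by
  rw [injective_iff_map_eq_one]
  intro w h1
  by_contra hne
  have hw' : w.toWord ≠ [] := by rwa [Ne, toWord_eq_nil_iff]
  obtain ⟨q, hq, hle⟩ := exists_max_letter hw'
  obtain ⟨A, e, B, hAB, hA, he⟩ := exists_split_first hle hq
  have hred := isReduced_toWord (x := w)
  rw [hAB] at hred hle
  have h2 := hφ.toWord_map_split_aux (hφ.eq_one_of_map_eq_one_of_supported q) (B.length + 1)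
    (by omega) hred hle hA he (supported _).one_mem (supported _).one_mem
  rw [← hAB, mk_toWord, h1] at h2
  simp at h2

variable [WellFoundedLT α]

theorem IsTriangular.toWord_map_split (hφ : IsTriangular φ u) {r : α}
    {A B : List (α × Bool)} {e : α × Bool} (hred : IsReduced (A ++ e :: B))
    (hle : ∀ x ∈ A ++ e :: B, x.1 ≤ r) (hA : ∀ x ∈ A, x.1 < r) (he : e.1 = r)
    {c d : FreeGroup α} (hc : c ∈ supported (Set.Iio r)) (hd : d ∈ supported (Set.Iio r)) :
    (c * φ (mk (A ++ e :: B)) * d).toWord = (c * φ (mk A) * preTail (u r) e).toWord ++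
      e :: (postTail (u r) e * φ (mk B) * d).toWord :=
  hφ.toWord_map_split_aux (hφ.eq_one_of_map_eq_one_of_supported r) _ (Nat.lt_succ_self _)
    hred hle hA he hc hd

/-- Twisted fixed words split at their first letter of maximal index. -/
theorem IsTriangular.split_of_map_eq (hφ : IsTriangular φ u) {r : α}
    {A B : List (α × Bool)} {e : α × Bool} (hred : IsReduced (A ++ e :: B))
    (hle : ∀ x ∈ A ++ e :: B, x.1 ≤ r) (hA : ∀ x ∈ A, x.1 < r) (he : e.1 = r)
    {c d : FreeGroup α} (hc : c ∈ supported (Set.Iio r)) (hd : d ∈ supported (Set.Iio r))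
    (h : c * φ (mk (A ++ e :: B)) * d = mk (A ++ e :: B)) :
    c * φ (mk A) * preTail (u r) e = mk A ∧ postTail (u r) e * φ (mk B) * d = mk B := by
  have h1 := hφ.toWord_map_split hred hle hA he hc hd
  rw [h, hred.toWord_mk] at h1
  have hX : c * φ (mk A) * preTail (u r) e ∈ supported (Set.Iio r) :=
    (supported _).mul_mem ((supported _).mul_mem hc (hφ.map_mem_Iio (mk_mem_supported hA)))
      (preTail_mem (hφ r).2 e)
  have key : ∀ (A A' B B' : List (α × Bool)), (∀ x ∈ A, x.1 < r) → (∀ x ∈ A', x.1 < r) →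
      A ++ e :: B = A' ++ e :: B' → A = A' ∧ B = B' := by
    intro A
    induction A with
    | nil =>
      intro A' B B' _ hA' h
      cases A' with
      | nil => simpa using h
      | cons x A' =>
        simp only [List.nil_append, List.cons_append, List.cons.injEq] at h
        exact absurd he (ne_of_lt (h.1 ▸ hA' x (by simp)))
    | cons y A ih =>
      intro A' B B' hA hA' h
      cases A' with
      | nil =>
        simp only [List.nil_append, List.cons_append, List.cons.injEq] at h
        exact absurd he (ne_of_lt (h.1 ▸ hA y (by simp)))
      | cons x A' =>
        simp only [List.cons_append, List.cons.injEq] at h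
        obtain ⟨rfl, h⟩ := h
        obtain ⟨rfl, rfl⟩ := ih A' B B' (fun z hz => hA z (by simp [hz]))
          (fun z hz => hA' z (by simp [hz])) h
        exact ⟨rfl, rfl⟩
  obtain ⟨h2, h3⟩ := key _ _ _ _ hA hX h1
  constructor
  · rw [← mk_toWord (x := c * _ * _), ← h2]
  · rw [← mk_toWord (x := postTail _ _ * _ * _), ← h3]

/-- A positively oriented top letter has trivial `preTail`, so nothing appears in front of it. A
reversed letter would acquire the inverse tail there, which is why loops are later rotated to start
with a positive top edge. -/
theorem IsTriangular.toWord_map_of_head (hφ : IsTriangular φ u) {s : α} {w : FreeGroup α}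
    (hw : w ∈ supported (Set.Iic s)) (hh : w.toWord.head? = some (s, true)) :
    (φ w).toWord.head? = some (s, true) := by
  cases hL : w.toWord with
  | nil => simp [hL] at hh
  | cons e L =>
    obtain rfl : e = (s, true) := by simpa [hL] using hh
    have hred := isReduced_toWord (x := w)
    have h1 := hφ.toWord_map_split (A := []) (r := s) (e := (s, true)) (B := L)
      (by simpa [hL] using hred) (fun x hx => hw x (by simpa [hL] using hx)) (by simp) rfl
      (supported _).one_mem (supported _).one_mem
    rw [List.nil_append, ← hL, mk_toWord] at h1
    simp only [one_mul, mul_one, ← one_eq_mk, _root_.map_one, preTail, if_true, toWord_one] at h1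
    rw [h1]; rfl

/-- If the image starts with the top letter, then the part A of w before its first top letter
satisfies φ(A) = 1, so A is empty by injectivity. -/
theorem IsTriangular.head?_of_map (hφ : IsTriangular φ u) {s : α} {w : FreeGroup α}
    (hw : w ∈ supported (Set.Iic s)) (hs : ∃ e ∈ w.toWord, e.1 = s)
    (hh : (φ w).toWord.head? = some (s, true)) : w.toWord.head? = some (s, true) := by
  obtain ⟨A, e, B, hAB, hA, he⟩ := exists_split_first hw hs
  have hred := isReduced_toWord (x := w)
  have h1 := hφ.toWord_map_split (r := s) (hAB ▸ hred) (hAB ▸ hw) hA he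
      (supported _).one_mem (supported _).one_mem
  have hX : 1 * φ (mk A) * preTail (u s) e ∈ supported (Set.Iio s) :=
    (supported _).mul_mem ((supported _).mul_mem (supported _).one_mem
      (hφ.map_mem_Iio (mk_mem_supported hA))) (preTail_mem (hφ s).2 e)
  rw [← hAB, mk_toWord, one_mul, mul_one] at h1
  rw [h1] at hh
  cases hW : (1 * φ (mk A) * preTail (u s) e).toWord with
  | cons z Z =>
    rw [hW] at hh
    simp only [List.cons_append, List.head?_cons, Option.some.injEq] at hh
    have := hX z (by rw [hW]; simp)
    rw [hh] at this
    exact absurd this (lt_irrefl s)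
  | nil =>
    rw [hW] at hh
    simp only [List.nil_append, List.head?_cons, Option.some.injEq] at hh
    subst hh
    have h3 : φ (mk A) = 1 := by simpa [preTail] using toWord_eq_nil_iff.1 hW
    have h4 : A = [] := by
      refine IsReduced.eq_nil_of_mk_eq_one (IsReduced.left (hAB ▸ hred)) ?_
      exact hφ.injective (h3.trans (_root_.map_one φ).symm)
    rw [hAB, h4]; rfl

/-- A cyclically reduced word that starts with its top letter and whose image is conjugate to it
is fixed. -/
theorem IsTriangular.map_eq_of_isConj [Finite α] (hφ : IsTriangular φ u) {s : α}
    {w : FreeGroup α} (hw : w ∈ supported (Set.Iic s)) (hh : w.toWord.head? = some (s, true))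
    (hl : IsCyclicallyReduced w.toWord) {g : FreeGroup α} (hg : φ w = g * w * g⁻¹) :
    φ w = w := by
  -- Conjugates of w in letters up to s that start with E_s and do not end with its reverse. This is
  -- preserved by φ and implies cyclic reducedness, so all iterates of w have length at most |w|.
  let Q : FreeGroup α → Prop := fun x => x ∈ supported (Set.Iic s) ∧
    x.toWord.head? = some (s, true) ∧ x⁻¹.toWord.head? ≠ some (s, true) ∧
    ∃ g, x = g * w * g⁻¹
  have hlast : ∀ x : FreeGroup α, x⁻¹.toWord.head? = x.toWord.getLast?.map
      (fun g => (g.1, !g.2)) := by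
    intro x
    simp [toWord_inv, FreeGroup.invRev]
  have hQw : Q w := by
    refine ⟨hw, hh, ?_, 1, by simp⟩
    rw [hlast]
    intro h
    obtain ⟨⟨i, b⟩, hab, hab'⟩ := Option.map_eq_some_iff.1 h
    simp only [Prod.mk.injEq, Bool.not_eq_true'] at hab'
    obtain ⟨rfl, rfl⟩ := hab'
    have := hl.2 _ hab _ hh rfl
    simp at this
  have hQφ : ∀ x, Q x → Q (φ x) := by
    rintro x ⟨h1, h2, h3, k, rfl⟩
    refine ⟨hφ.map_mem_Iic h1, hφ.toWord_map_of_head h1 h2, ?_, φ k * g, ?_⟩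
    · rw [← _root_.map_inv]
      intro h
      refine h3 (hφ.head?_of_map ((supported _).inv_mem h1) ?_ h)
      refine ⟨(s, false), ?_, rfl⟩
      rw [toWord_inv, mem_invRev]
      exact List.mem_of_head? h2
    · rw [_root_.map_mul, _root_.map_mul, hg, _root_.map_inv]
      group
  have hQred : ∀ x, Q x → IsCyclicallyReduced x.toWord := by
    rintro x ⟨h1, h2, h3, -⟩
    refine ⟨isReduced_toWord, ?_⟩
    intro a ha b hb hab
    rw [h2] at hb
    obtain rfl : (s, true) = b := by simpa using hb
    by_contra hne
    refine h3 ?_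
    rw [hlast, ha]
    rcases a with ⟨i, _ | _⟩
    · simpa using hab
    · exact absurd rfl hne
  have hQn : ∀ n, Q (φ^[n] w) := by
    intro n
    induction n with
    | zero => exact hQw
    | succ n ih => rw [Function.iterate_succ_apply']; exact hQφ _ ih
  -- Two iterates coincide; injectivity of φ cancels the first i applications, so w itself is
  -- periodic.
  obtain ⟨i, -, j, -, hij, h⟩ := (Set.infinite_univ (α := ℕ)).exists_ne_map_eq_of_mapsTo
    (f := fun n => φ^[n] w) (fun n _ => by
      obtain ⟨k, hk⟩ := (hQn n).2.2.2
      exact norm_le_of_conj hl (hQred _ (hQn n)) hk) (finite_norm_le w.norm)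
  wlog hlt : i < j generalizing i j
  · exact this j i hij.symm h.symm (by omega)
  obtain ⟨k, hk, rfl⟩ : ∃ k, 0 < k ∧ j = i + k := ⟨j - i, by omega, by omega⟩
  refine hφ.map_eq_of_iterate_eq hk ?_
  refine (hφ.injective.iterate i) ?_
  rw [← Function.iterate_add_apply]
  exact h.symm

end

end FreeGroup

/-! ### Roots of cyclically reduced words. -/

namespace FreeGroup

variable {α : Type*}

theorem isCyclicallyReduced_invRev {L : List (α × Bool)} (h : IsCyclicallyReduced L) :
    IsCyclicallyReduced (invRev L) := by
  refine ⟨isReduced_invRev h.1, ?_⟩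
  intro a ha b hb hab
  simp only [invRev, List.getLast?_reverse, List.head?_map, List.head?_reverse,
    List.getLast?_map, Option.mem_def, Option.map_eq_some_iff] at ha hb
  obtain ⟨x, hx, rfl⟩ := ha
  obtain ⟨y, hy, rfl⟩ := hb
  simp only at hab
  simp only [h.2 y hy x hx hab.symm]

/-- Roots of cyclically reduced words. -/
theorem exists_root {κ : List (α × Bool)} (hκ : IsCyclicallyReduced κ) (hne : κ ≠ []) :
    ∃ (β : List (α × Bool)) (n : ℕ), n ≠ 0 ∧ IsCyclicallyReduced β ∧
      κ = (List.replicate n β).flatten ∧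
      ∀ x, Commute x (mk κ) ↔ ∃ k : ℤ, x = mk β ^ k := by
  classical
  have h1 : mk κ ≠ 1 := fun h => hne (hκ.1.eq_nil_of_mk_eq_one h)
  obtain ⟨b, hb⟩ := exists_centralizer_eq_zpowers h1
  obtain ⟨b, n, hκb, hb⟩ : ∃ (b : FreeGroup α) (n : ℕ), mk κ = b ^ n ∧
      ∀ x, Commute x (mk κ) ↔ ∃ k : ℤ, x = b ^ k := by
    obtain ⟨k, hk⟩ := (hb (mk κ)).1 (Commute.refl _)
    obtain ⟨n, rfl | rfl⟩ := k.eq_nat_or_neg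
    · exact ⟨b, n, by simpa using hk, hb⟩
    · refine ⟨b⁻¹, n, by simpa using hk, fun x => (hb x).trans ⟨?_, ?_⟩⟩
      · rintro ⟨k, rfl⟩; exact ⟨-k, by simp⟩
      · rintro ⟨k, rfl⟩; exact ⟨-k, by simp⟩
  have hn : n ≠ 0 := by rintro rfl; exact h1 (by simpa using hκb)
  have h2 : κ = reduceCyclically.conjugator b.toWord ++
      (List.replicate n (reduceCyclically b.toWord)).flatten ++
      invRev (reduceCyclically.conjugator b.toWord) := by
    rw [← hκ.1.toWord_mk, hκb, toWord_pow,
      reduceCyclically.reduce_flatten_replicate isReduced_toWord, if_neg hn]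
  -- A nonempty conjugator would make κ start with some letter and end with its inverse.
  have h3 : reduceCyclically.conjugator b.toWord = [] := by
    cases hc : reduceCyclically.conjugator b.toWord with
    | nil => rfl
    | cons a L =>
      exfalso
      rw [hc] at h2
      have h4 := hκ.2 (a.1, !a.2) (by
        rw [h2, invRev_cons, ← List.append_assoc]; exact List.getLast?_concat) a (by rw [h2]; simp) rfl
      simp at h4
  have h4 := reduceCyclically.conj_conjugator_reduceCyclically b.toWord
  rw [h3] at h2 h4
  simp only [List.nil_append, invRev_empty, List.append_nil] at h2 h4
  rw [h4] at h2
  refine ⟨b.toWord, n, hn, ?_, h2, by rwa [mk_toWord]⟩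
  rw [← h4]
  exact reduceCyclically.isCyclicallyReduced isReduced_toWord

end FreeGroup

/-! ### Edge paths: powers of loops and cyclic reduction. -/

open FreeGroup

namespace EdgeSeq

variable {m : ℕ}

theorem mk_zpow (β : EdgeSeq m) (k : ℤ) : FreeGroup.mk (β.zpow k) = FreeGroup.mk β ^ k := by
  cases k with
  | ofNat n => simp [EdgeSeq.zpow, ← pow_mk]
  | negSucc n =>
    simp only [EdgeSeq.zpow, ← pow_mk, mk_invRev, zpow_negSucc, inv_pow]

theorem isReduced_zpow {β : EdgeSeq m} (h : IsCyclicallyReduced β) (k : ℤ) :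
    IsReduced (β.zpow k) := by
  cases k with
  | ofNat n => exact (h.flatten_replicate n).1
  | negSucc n => exact ((isCyclicallyReduced_invRev h).flatten_replicate _).1

theorem mem_flatten_replicate {β : EdgeSeq m} {n : ℕ} {e : Fin m × Bool}
    (h : e ∈ (List.replicate n β).flatten) : e ∈ β := by
  obtain ⟨l, hl, he⟩ := List.mem_flatten.1 h
  rwa [List.eq_of_mem_replicate hl] at he

theorem Below.invRev {β : EdgeSeq m} {r : Fin m} (h : β.Below r) :
    EdgeSeq.Below (FreeGroup.invRev β) r := fun e he => h (e.1, !e.2) (mem_invRev.1 he)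

theorem Below.zpow {β : EdgeSeq m} {r : Fin m} (h : β.Below r) (k : ℤ) : (β.zpow k).Below r := by
  cases k with
  | ofNat n => exact fun e he => h e (mem_flatten_replicate he)
  | negSucc n => exact fun e he => h.invRev e (mem_flatten_replicate he)

theorem Below.append {β γ : EdgeSeq m} {r : Fin m} (h : β.Below r) (h' : γ.Below r) :
    EdgeSeq.Below (β ++ γ) r := fun e he => (List.mem_append.1 he).elim (h e) (h' e)

end EdgeSeq

namespace FilteredGraph

variable {V : Type u} {m : ℕ} {G : FilteredGraph V m}

theorem isPath_append_iff {a b : V} {α β : EdgeSeq m} :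
    G.IsPath a (α ++ β) b ↔ ∃ c, G.IsPath a α c ∧ G.IsPath c β b := by
  refine ⟨fun h => ?_, fun ⟨c, h1, h2⟩ => h1.append h2⟩
  induction α generalizing a with
  | nil => exact ⟨a, rfl, h⟩
  | cons e α ih =>
    obtain ⟨c, h1, h2⟩ := ih h.2
    exact ⟨c, ⟨h.1, h1⟩, h2⟩

theorem IsPath.terminal_unique {a b c : V} {α : EdgeSeq m} (h : G.IsPath a α b)
    (h' : G.IsPath a α c) : b = c := by
  induction α generalizing a with
  | nil => exact Eq.trans (Eq.symm h) h'
  | cons e α ih => exact ih h.2 h'.2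

theorem IsPath.initial_unique {a a' b b' : V} {α : EdgeSeq m} (hα : α ≠ []) (h : G.IsPath a α b)
    (h' : G.IsPath a' α b') : a = a' := by
  cases α with
  | nil => exact absurd rfl hα
  | cons e α => exact h.1.trans h'.1.symm

theorem IsPath.zpow {a : V} {β : EdgeSeq m} (h : G.IsPath a β a) (k : ℤ) :
    G.IsPath a (β.zpow k) a := by
  have key : ∀ (β : EdgeSeq m) (n : ℕ), G.IsPath a β a →
      G.IsPath a (List.replicate n β).flatten a := by
    intro β n h
    induction n with
    | zero => rfl
    | succ n ih => rw [List.replicate_succ, List.flatten_cons]; exact h.append ih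
  cases k with
  | ofNat n => exact key _ _ h
  | negSucc n => exact key _ _ h.invRev

theorem IsPath.of_replicate {a : V} {β : EdgeSeq m} {n : ℕ} (hn : n ≠ 0)
    (h : G.IsPath a (List.replicate n β).flatten a) : G.IsPath a β a := by
  rcases eq_or_ne β [] with rfl | hβ
  · rfl
  obtain ⟨n, rfl⟩ := Nat.exists_eq_succ_of_ne_zero hn
  rw [List.replicate_succ, List.flatten_cons, isPath_append_iff] at h
  obtain ⟨c, h1, h2⟩ := h
  cases n with
  | zero =>
    have h2 : c = a := h2
    rwa [h2] at h1
  | succ n =>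
    rw [List.replicate_succ, List.flatten_cons, isPath_append_iff] at h2
    obtain ⟨d, h2, -⟩ := h2
    rwa [← IsPath.initial_unique hβ h1 h2] at h1

/-- A reduced loop or its inverse is conjugate along a path to a cyclically reduced loop starting
with its top edge. -/
theorem exists_conj_isCyclicallyReduced {t : V} {γ : EdgeSeq m} {r : Fin m}
    (hred : IsReduced γ) (hne : γ ≠ []) (hp : G.IsPath t γ t) (hr : γ.Below r) :
    ∃ (δ κ : EdgeSeq m) (c : V) (s : Fin m), G.IsPath t δ c ∧ δ.Below r ∧
      G.IsPath c ((s, true) :: κ) c ∧ s < r ∧ (∀ e ∈ κ, e.1 ≤ s) ∧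
      IsCyclicallyReduced ((s, true) :: κ) ∧
      (FreeGroup.mk γ = FreeGroup.mk δ * FreeGroup.mk ((s, true) :: κ) * (FreeGroup.mk δ)⁻¹ ∨
        (FreeGroup.mk γ)⁻¹ =
          FreeGroup.mk δ * FreeGroup.mk ((s, true) :: κ) * (FreeGroup.mk δ)⁻¹) := by
  have h1 := reduceCyclically.conj_conjugator_reduceCyclically γ
  have hcyc := reduceCyclically.isCyclicallyReduced hred
  set σ := reduceCyclically.conjugator γ
  set κ₀ := reduceCyclically γ
  have hκ₀ne : κ₀ ≠ [] := by
    intro h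
    rw [h] at h1
    refine hne (hred.eq_nil_of_mk_eq_one ?_)
    rw [← h1, List.append_nil, mk_append, mk_invRev, mul_inv_cancel]
  obtain ⟨s, ⟨e, he, hes⟩, hle⟩ := exists_max_letter hκ₀ne
  have hmk : FreeGroup.mk γ = FreeGroup.mk σ * FreeGroup.mk κ₀ * (FreeGroup.mk σ)⁻¹ := by
    rw [← h1, mk_append, mk_append, mk_invRev]
  have hσr : EdgeSeq.Below σ r := fun x hx => hr x (by rw [← h1]; simp [hx])
  have hκr : EdgeSeq.Below κ₀ r := fun x hx => hr x (by rw [← h1]; simp [hx])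
  have hsr : s < r := hes ▸ hκr e he
  obtain ⟨c₀, hσ, hκ⟩ : ∃ c₀, G.IsPath t σ c₀ ∧ G.IsPath c₀ κ₀ c₀ := by
    rw [← h1] at hp
    obtain ⟨d, h2, h3⟩ := isPath_append_iff.1 hp
    obtain ⟨c₀, h4, h5⟩ := isPath_append_iff.1 h2
    refine ⟨c₀, h4, ?_⟩
    have h6 := h3.invRev
    rw [invRev_invRev] at h6
    rwa [h4.terminal_unique h6] at h5 ⊢
  -- Rotate the loop to an occurrence of the positive top edge; the part passed over is appended to
  -- the conjugating path.
  have key : ∀ κ' : EdgeSeq m, (s, true) ∈ κ' → IsCyclicallyReduced κ' → (∀ e ∈ κ', e.1 ≤ s) →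
      G.IsPath c₀ κ' c₀ → ∃ (δ κ : EdgeSeq m) (c : V), G.IsPath t δ c ∧ δ.Below r ∧
      G.IsPath c ((s, true) :: κ) c ∧ (∀ e ∈ κ, e.1 ≤ s) ∧
      IsCyclicallyReduced ((s, true) :: κ) ∧
      FreeGroup.mk σ * FreeGroup.mk κ' * (FreeGroup.mk σ)⁻¹ =
        FreeGroup.mk δ * FreeGroup.mk ((s, true) :: κ) * (FreeGroup.mk δ)⁻¹ := by
    intro κ' hs hc hle hp
    obtain ⟨κ₁, κ₂, rfl⟩ := List.append_of_mem hs
    obtain ⟨c, h2, h3⟩ := isPath_append_iff.1 hp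
    refine ⟨σ ++ κ₁, κ₂ ++ κ₁, c, hσ.append h2, ?_, h3.append h2, ?_,
      isCyclicallyReduced_append_comm hc, ?_⟩
    · exact hσr.append fun x hx => (hle x (by simp [hx])).trans_lt hsr
    · intro x hx
      exact hle x (by simp at hx ⊢; tauto)
    · rw [← List.cons_append, mk_append, mk_append, mk_append]
      group
  -- If the top edge found is crossed backwards, the inverse loop is used instead.
  rcases e with ⟨i, _ | _⟩
  · obtain rfl : i = s := hes
    obtain ⟨δ, κ, c, h2, h3, h4, h5, h6, h7⟩ := key (invRev κ₀) (mem_invRev.2 he)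
      (isCyclicallyReduced_invRev hcyc) (fun x hx => hle (x.1, !x.2) (mem_invRev.1 hx)) hκ.invRev
    refine ⟨δ, κ, c, i, h2, h3, h4, hsr, h5, h6, Or.inr ?_⟩
    rw [← h7, hmk, mk_invRev]
    group
  · obtain rfl : i = s := hes
    obtain ⟨δ, κ, c, h2, h3, h4, h5, h6, h7⟩ := key κ₀ he hcyc hle hκ
    exact ⟨δ, κ, c, i, h2, h3, h4, hsr, h5, h6, Or.inl (hmk.trans h7)⟩

end FilteredGraph

/-! ### Common fixed loops of twisted triangular endomorphisms. -/

namespace FilteredGraph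

variable {V : Type u} {m : ℕ} {G : FilteredGraph V m}

/-- The conclusion of one twisted endomorphism fixing a cyclically reduced loop. -/
theorem map_eq_and_commute_of_twisted {φ : FreeGroup (Fin m) →* FreeGroup (Fin m)}
    {u : Fin m → FreeGroup (Fin m)} (hφ : IsTriangular φ u) {s : Fin m} {w x : FreeGroup (Fin m)}
    (hw : w ∈ supported (Set.Iic s)) (hh : w.toWord.head? = some (s, true))
    (hl : IsCyclicallyReduced w.toWord) (h : x * φ w * x⁻¹ = w) : φ w = w ∧ Commute x w := by
  have h1 : φ w = w := hφ.map_eq_of_isConj hw hh hl (g := x⁻¹) (by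
    nth_rw 2 [← h]; group)
  refine ⟨h1, ?_⟩
  rw [h1] at h
  rw [commute_iff_eq]
  nth_rw 2 [← h]
  group

/-- The twists lie below the top edge E_q of γ, so the fixed equation can be cut at the first E_q.
The initial piece, including that edge if it is crossed backwards, is a common twisted fixed path,
which `hno` forbids. -/
theorem not_fixed_of_max_letter {φ ψ : FreeGroup (Fin m) →* FreeGroup (Fin m)}
    {u v : Fin m → FreeGroup (Fin m)} (hφ : IsTriangular φ u) (hψ : IsTriangular ψ v)
    {c : V} {r q : Fin m} {x y : FreeGroup (Fin m)}
    (hx : x ∈ supported (Set.Iio q)) (hy : y ∈ supported (Set.Iio q))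
    (hno : ∀ (σ : EdgeSeq m) (d : V), G.IsPath c σ d → σ.Below r →
      ¬ (x * φ (FreeGroup.mk σ) = FreeGroup.mk σ ∧ y * ψ (FreeGroup.mk σ) = FreeGroup.mk σ))
    {γ : EdgeSeq m} (hred : IsReduced γ) (hp : G.IsPath c γ c) (hr : γ.Below r)
    (hq : ∃ e ∈ γ, e.1 = q) (hle : ∀ e ∈ γ, e.1 ≤ q)
    (hγφ : x * φ (FreeGroup.mk γ) * x⁻¹ = FreeGroup.mk γ)
    (hγψ : y * ψ (FreeGroup.mk γ) * y⁻¹ = FreeGroup.mk γ) : False := by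
  obtain ⟨A, e, B, rfl, hA, he⟩ := exists_split_first hle hq
  obtain ⟨h1, -⟩ := hφ.split_of_map_eq hred hle hA he hx ((supported _).inv_mem hx) hγφ
  obtain ⟨h2, -⟩ := hψ.split_of_map_eq hred hle hA he hy ((supported _).inv_mem hy) hγψ
  obtain ⟨d, hd, hd'⟩ := isPath_append_iff.1 hp
  rcases e with ⟨i, _ | _⟩
  · obtain rfl : i = q := he
    have hd2 : G.IsPath d [(i, false)] (G.terminal (i, false)) := ⟨hd'.1, rfl⟩
    refine hno (A ++ [(i, false)]) _ (hd.append hd2) (fun z hz => hr z ?_) ⟨?_, ?_⟩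
    · simp at hz ⊢; tauto
    · rw [mk_append, _root_.map_mul, hφ.map_letter]
      nth_rw 2 [← h1]
      simp [preTail, postTail, mul_assoc]
    · rw [mk_append, _root_.map_mul, hψ.map_letter]
      nth_rw 2 [← h2]
      simp [preTail, postTail, mul_assoc]
  · refine hno A d hd (fun z hz => hr z (by simp [hz])) ⟨?_, ?_⟩
    · simpa [preTail] using h1
    · simpa [preTail] using h2

/-- If two twisted triangular endomorphisms have a common fixed loop but no common fixed path,
then after moving the base point along a path both twists are powers of a fixed loop, whose powers
are the only common fixed loops. -/
theorem exists_root_of_twisted_fixed {φ ψ : FreeGroup (Fin m) →* FreeGroup (Fin m)}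
    {u v : Fin m → FreeGroup (Fin m)} (hφ : IsTriangular φ u) (hψ : IsTriangular ψ v)
    {t : V} {r : Fin m} {x y : FreeGroup (Fin m)}
    (hno : ∀ (σ : EdgeSeq m) (d : V), G.IsPath t σ d → σ.Below r →
      ¬ (x * φ (FreeGroup.mk σ) = FreeGroup.mk σ ∧ y * ψ (FreeGroup.mk σ) = FreeGroup.mk σ))
    {γ : EdgeSeq m} (hred : IsReduced γ) (hne : γ ≠ []) (hp : G.IsPath t γ t) (hr : γ.Below r)
    (hγφ : x * φ (FreeGroup.mk γ) * x⁻¹ = FreeGroup.mk γ)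
    (hγψ : y * ψ (FreeGroup.mk γ) * y⁻¹ = FreeGroup.mk γ) :
    ∃ (δ β : EdgeSeq m) (c : V) (a b : ℤ), G.IsPath t δ c ∧ δ.Below r ∧ G.IsPath c β c ∧
      β.Below r ∧ β ≠ [] ∧ IsCyclicallyReduced β ∧
      φ (FreeGroup.mk β) = FreeGroup.mk β ∧ ψ (FreeGroup.mk β) = FreeGroup.mk β ∧
      (FreeGroup.mk δ)⁻¹ * x * φ (FreeGroup.mk δ) = FreeGroup.mk β ^ a ∧
      (FreeGroup.mk δ)⁻¹ * y * ψ (FreeGroup.mk δ) = FreeGroup.mk β ^ b ∧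
      (∀ (σ : EdgeSeq m) (d : V), G.IsPath c σ d → σ.Below r →
        ¬ (FreeGroup.mk β ^ a * φ (FreeGroup.mk σ) = FreeGroup.mk σ ∧
          FreeGroup.mk β ^ b * ψ (FreeGroup.mk σ) = FreeGroup.mk σ)) ∧
      ∀ γ' : EdgeSeq m, IsReduced γ' → G.IsPath c γ' c → γ'.Below r →
        FreeGroup.mk β ^ a * φ (FreeGroup.mk γ') * (FreeGroup.mk β ^ a)⁻¹ = FreeGroup.mk γ' →
        FreeGroup.mk β ^ b * ψ (FreeGroup.mk γ') * (FreeGroup.mk β ^ b)⁻¹ = FreeGroup.mk γ' →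
        ∃ k : ℤ, FreeGroup.mk γ' = FreeGroup.mk β ^ k := by
  obtain ⟨δ, κ, c, s, hδ, hδr, hκp, hsr, hκs, hκc, hconj⟩ :=
    exists_conj_isCyclicallyReduced hred hne hp hr
  set K : FreeGroup (Fin m) := FreeGroup.mk ((s, true) :: κ) with hK
  set D : FreeGroup (Fin m) := FreeGroup.mk δ with hD
  have hKw : K.toWord = (s, true) :: κ := hκc.1.toWord_mk
  have hKs : K ∈ supported (Set.Iic s) := mk_mem_supported (by
    intro e he
    rcases List.mem_cons.1 he with rfl | he
    · exact Set.mem_Iic.2 le_rfl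
    · exact hκs e he)
  -- Moving the base point along δ replaces the twist x by δ⁻¹ x φ(δ), the tail of E_r after sliding
  -- along δ.
  have tw : ∀ (φ : FreeGroup (Fin m) →* FreeGroup (Fin m)) (x : FreeGroup (Fin m)),
      x * φ (FreeGroup.mk γ) * x⁻¹ = FreeGroup.mk γ →
      (D⁻¹ * x * φ D) * φ K * (D⁻¹ * x * φ D)⁻¹ = K := by
    intro φ x h
    have h1 : x * φ (D * K * D⁻¹) * x⁻¹ = D * K * D⁻¹ := by
      rcases hconj with h' | h'
      · rw [← h']; exact h
      · rw [← h', _root_.map_inv]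
        nth_rw 2 [← h]
        group
    calc (D⁻¹ * x * φ D) * φ K * (D⁻¹ * x * φ D)⁻¹ = D⁻¹ * (x * φ (D * K * D⁻¹) * x⁻¹) * D := by
          simp only [_root_.map_mul, _root_.map_inv]; group
      _ = K := by rw [h1]; group
  obtain ⟨hφK, hxK⟩ := map_eq_and_commute_of_twisted hφ hKs (by rw [hKw]; rfl)
    (by rw [hKw]; exact hκc) (tw φ x hγφ)
  obtain ⟨hψK, hyK⟩ := map_eq_and_commute_of_twisted hψ hKs (by rw [hKw]; rfl)
    (by rw [hKw]; exact hκc) (tw ψ y hγψ)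
  obtain ⟨β, n, hn, hβc, hκβ, hcent⟩ := exists_root hκc (by simp)
  obtain ⟨a, ha⟩ := (hcent _).1 hxK
  obtain ⟨b, hb⟩ := (hcent _).1 hyK
  have hKβ : K = FreeGroup.mk β ^ n := by rw [hK, hκβ, pow_mk]
  have hfix : ∀ φ : FreeGroup (Fin m) →* FreeGroup (Fin m), φ K = K →
      φ (FreeGroup.mk β) = FreeGroup.mk β := by
    intro φ h
    rw [hKβ, map_pow] at h
    exact IsMulTorsionFree.pow_left_injective hn h
  have hβne : β ≠ [] := by
    rintro rfl
    simp at hκβ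
  have hβhead : ∀ N, N ≠ 0 → (List.replicate N β).flatten.head? = some (s, true) := by
    intro N hN
    rw [List.head?_flatten_replicate hN, ← List.head?_flatten_replicate hn, ← hκβ]; rfl
  have hβs : ∀ e ∈ β, e.1 ≤ s := by
    intro e he
    have : e ∈ (s, true) :: κ := by
      rw [hκβ]
      exact List.mem_flatten.2 ⟨β, List.mem_replicate.2 ⟨hn, rfl⟩, he⟩
    rcases List.mem_cons.1 this with rfl | h
    · exact le_rfl
    · exact hκs e h
  have hβp : G.IsPath c β c := IsPath.of_replicate hn (hκβ ▸ hκp)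
  have hφβ := hfix φ hφK
  have hψβ := hfix ψ hψK
  have hno' : ∀ (σ : EdgeSeq m) (d : V), G.IsPath c σ d → σ.Below r →
      ¬ (FreeGroup.mk β ^ a * φ (FreeGroup.mk σ) = FreeGroup.mk σ ∧
        FreeGroup.mk β ^ b * ψ (FreeGroup.mk σ) = FreeGroup.mk σ) := by
    rintro σ d h1 h2 ⟨h3, h4⟩
    refine hno (δ ++ σ) d (hδ.append h1) (hδr.append h2) ⟨?_, ?_⟩
    · rw [mk_append, _root_.map_mul, ← hD]
      nth_rw 2 [← h3]
      rw [← ha]; group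
    · rw [mk_append, _root_.map_mul, ← hD]
      nth_rw 2 [← h4]
      rw [← hb]; group
  refine ⟨δ, β, c, a, b, hδ, hδr, hβp, fun e he => (hβs e he).trans_lt hsr, hβne, hβc,
    hφβ, hψβ, ha, hb, hno', ?_⟩
  intro γ' hred' hp' hr' h1 h2
  rcases eq_or_ne γ' [] with rfl | hne'
  · exact ⟨0, rfl⟩
  obtain ⟨q, hq, hle⟩ := exists_max_letter hne'
  -- If γ' is higher than s, the twists lie below its top edge and `not_fixed_of_max_letter`
  -- applies. Otherwise γ' is flanked by powers of β.
  rcases lt_or_ge s q with hsq | hqs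
  · have hmem : ∀ k : ℤ, FreeGroup.mk β ^ k ∈ supported (Set.Iio q) := fun k =>
      (supported _).zpow_mem (mk_mem_supported fun e he => (hβs e he).trans_lt hsq) k
    exact (not_fixed_of_max_letter hφ hψ (hmem a) (hmem b) hno' hred' hp' hr' hq hle h1 h2).elim
  · set X := FreeGroup.mk γ' with hX
    set b' := FreeGroup.mk β with hb'
    have hb1 : b' ≠ 1 := fun h => hβne (hβc.1.eq_nil_of_mk_eq_one h)
    -- A product longer than X leaves the first and last letters of the flanking powers uncancelled.
    -- Hence it is cyclically reduced and starts with E_s.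
    obtain ⟨N, hN⟩ := exists_norm_lt_pow_mul_pow hb1 X X.norm
    have hN0 : N ≠ 0 := by rintro rfl; simp at hN
    have hpw : (b' ^ N).toWord = (List.replicate N β).flatten := by
      rw [hb', pow_mk, (hβc.flatten_replicate N).1.toWord_mk]
    have hXs : X ∈ supported (Set.Iic s) := mk_mem_supported fun e he => (hle e he).trans hqs
    have hbs : b' ∈ supported (Set.Iic s) := mk_mem_supported hβs
    have hh : (b' ^ N * X * b' ^ N).toWord.head? = (b' ^ N).toWord.head? := by
      rw [mul_assoc] at hN ⊢
      refine head?_toWord_mul ?_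
      have := norm_mul_le X (b' ^ N)
      omega
    have hl : (b' ^ N * X * b' ^ N).toWord.getLast? = (b' ^ N).toWord.getLast? := by
      refine getLast?_toWord_mul ?_
      have := norm_mul_le (b' ^ N) X
      omega
    have hcyc : IsCyclicallyReduced (b' ^ N * X * b' ^ N).toWord := by
      refine ⟨isReduced_toWord, ?_⟩
      rw [hh, hl, hpw]
      exact (hβc.flatten_replicate N).2
    have hs : b' ^ N * X * b' ^ N ∈ supported (Set.Iic s) :=
      (supported _).mul_mem ((supported _).mul_mem ((supported _).pow_mem hbs _) hXs)
        ((supported _).pow_mem hbs _)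
    have hh' : (b' ^ N * X * b' ^ N).toWord.head? = some (s, true) := by
      rw [hh, hpw, hβhead N hN0]
    have htw : ∀ (φ : FreeGroup (Fin m) →* FreeGroup (Fin m)) (a : ℤ), φ b' = b' →
        b' ^ a * φ X * (b' ^ a)⁻¹ = X →
        b' ^ a * φ (b' ^ N * X * b' ^ N) * (b' ^ a)⁻¹ = b' ^ N * X * b' ^ N := by
      intro φ a hφ h
      have hc1 : b' ^ a * b' ^ N = b' ^ N * b' ^ a := by
        rw [← zpow_natCast, ← zpow_add, ← zpow_add, add_comm]
      have hc2 : b' ^ N * (b' ^ a)⁻¹ = (b' ^ a)⁻¹ * b' ^ N := by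
        rw [← zpow_natCast, ← zpow_neg, ← zpow_add, ← zpow_add, add_comm]
      calc b' ^ a * φ (b' ^ N * X * b' ^ N) * (b' ^ a)⁻¹
          = (b' ^ a * b' ^ N) * φ X * (b' ^ N * (b' ^ a)⁻¹) := by
            simp only [_root_.map_mul, map_pow, hφ, mul_assoc]
        _ = b' ^ N * (b' ^ a * φ X * (b' ^ a)⁻¹) * b' ^ N := by
            rw [hc1, hc2]; simp only [mul_assoc]
        _ = b' ^ N * X * b' ^ N := by rw [h]
    have hcomm : ∀ a : ℤ, a ≠ 0 → Commute (b' ^ a) (b' ^ N * X * b' ^ N) →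
        ∃ k : ℤ, X = b' ^ k := by
      intro a ha h
      have h3 : Commute (b' ^ N * X * b' ^ N) b' := commute_of_pow_right ha h.symm
      have h4 : Commute (b' ^ N) b' := Commute.pow_self b' N
      have h5 : Commute X b' := by
        have : X = (b' ^ N)⁻¹ * (b' ^ N * X * b' ^ N) * (b' ^ N)⁻¹ := by group
        rw [this]
        exact (h4.inv_left.mul_left h3).mul_left h4.inv_left
      refine (hcent X).1 ?_
      rw [← hK, hKβ]
      exact h5.pow_right n
    have h3 := (map_eq_and_commute_of_twisted hφ hs hh' hcyc (htw φ a hφβ h1)).2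
    have h4 := (map_eq_and_commute_of_twisted hψ hs hh' hcyc (htw ψ b hψβ h2)).2
    -- The exponents cannot both vanish: the trivial path would then be a common twisted fixed path.
    rcases eq_or_ne a 0 with rfl | ha0
    · rcases eq_or_ne b 0 with rfl | hb0
      · exact (hno' [] c rfl (by simp [EdgeSeq.Below]) ⟨by simp [← one_eq_mk],
          by simp [← one_eq_mk]⟩).elim
      · exact hcomm b hb0 h4
    · exact hcomm a ha0 h3

end FilteredGraph

/-! ### Graph maps as homomorphisms and the normal form at one edge. -/

namespace GraphMap

variable {U : Type w} {V : Type u} {W : Type v} {l m n : ℕ}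
  {F : FilteredGraph U l} {G : FilteredGraph V m} {H : FilteredGraph W n}

/-- The homomorphism of free groups on the edges. -/
def hom (p : GraphMap G H) : FreeGroup (Fin m) →* FreeGroup (Fin n) :=
  FreeGroup.lift fun i => FreeGroup.mk (p.onEdge i)

theorem hom_of (p : GraphMap G H) (i : Fin m) :
    p.hom (FreeGroup.of i) = FreeGroup.mk (p.onEdge i) := by simp [hom]

theorem mk_onPath (p : GraphMap G H) (α : EdgeSeq m) :
    FreeGroup.mk (p.onPath α) = p.hom (FreeGroup.mk α) := by
  induction α with
  | nil => rw [← one_eq_mk, _root_.map_one]; rfl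
  | cons e α ih =>
    have h1 : p.onPath (e :: α) =
        (if e.2 then p.onEdge e.1 else FreeGroup.invRev (p.onEdge e.1)) ++ p.onPath α := rfl
    rw [h1, mk_append, ih, mk_cons e α, _root_.map_mul]
    congr 1
    rcases e with ⟨i, _ | _⟩
    · have : FreeGroup.mk [(i, false)] = (FreeGroup.of i)⁻¹ := by
        simp [FreeGroup.of, inv_mk, FreeGroup.invRev]
      rw [this, _root_.map_inv, hom_of]
      exact mk_invRev _
    · exact (hom_of p i).symm

theorem hom_comp (q : GraphMap G H) (p : GraphMap F G) : (q.comp p).hom = q.hom.comp p.hom := by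
  ext i
  rw [hom_of, MonoidHom.comp_apply, hom_of, ← mk_onPath]; rfl

theorem hom_id (G : FilteredGraph V m) : (GraphMap.id G).hom = MonoidHom.id _ := by
  ext i
  rw [hom_of]; rfl

/-- When the vertex maps agree, the homotopy can move every vertex along the trivial path. -/
theorem freelyHomotopic_of_hom_eq {p q : GraphMap G H} (hv : ∀ a, p.onVert a = q.onVert a)
    (h : p.hom = q.hom) : p.FreelyHomotopic q := by
  refine ⟨fun _ => [], hv, fun i => ⟨?_, ?_, ?_⟩⟩
  · rw [List.append_nil, ← hv]; exact p.isPath_onEdge i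
  · rw [List.nil_append, hv]; exact q.isPath_onEdge i
  · rw [List.append_nil, List.nil_append, ← hom_of, ← hom_of, h]

/-- The element by which an upper triangular map multiplies an edge. -/
def tail (f : GraphMap G G) (i : Fin m) : FreeGroup (Fin m) :=
  (FreeGroup.of i)⁻¹ * f.hom (FreeGroup.of i)

theorem tail_of_onEdge {f : GraphMap G G} {i : Fin m} {α : EdgeSeq m}
    (h : f.onEdge i = (i, true) :: α) : f.tail i = FreeGroup.mk α := by
  rw [tail, hom_of, h, mk_cons, FreeGroup.of, inv_mul_cancel_left]

theorem IsUpperTriangular.isTriangular {f : GraphMap G G} (hf : f.IsUpperTriangular) :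
    IsTriangular f.hom f.tail := by
  intro i
  refine ⟨by rw [tail, mul_inv_cancel_left], ?_⟩
  obtain ⟨α, -, h1, h2⟩ := hf.2 i
  rw [tail_of_onEdge h2]
  exact mk_mem_supported h1

theorem isCommonNielsen_iff {f g : GraphMap G G} (hf : ∀ a, f.onVert a = a)
    (hg : ∀ a, g.onVert a = a) {ρ : EdgeSeq m} :
    IsCommonNielsen f g ρ ↔ IsReduced ρ ∧ (∃ a b, G.IsPath a ρ b) ∧
      f.hom (FreeGroup.mk ρ) = FreeGroup.mk ρ ∧ g.hom (FreeGroup.mk ρ) = FreeGroup.mk ρ := by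
  constructor
  · rintro ⟨h1, a, b, ⟨-, h2, h3⟩, ⟨-, -, h4⟩⟩
    rw [mk_onPath] at h3 h4
    exact ⟨h1, ⟨a, b, h2⟩, h3, h4⟩
  · rintro ⟨h1, ⟨a, b, h2⟩, h3, h4⟩
    refine ⟨h1, a, b, ⟨?_, h2, by rw [mk_onPath, h3]⟩, ⟨?_, h2, by rw [mk_onPath, h4]⟩⟩
    · simpa only [hf] using f.isPath_onPath h2
    · simpa only [hg] using g.isPath_onPath h2

/-- The normal form of a pair of upper triangular maps at the edge `E_r`. -/
def HasNormalForm (f g : GraphMap G G) (r : Fin m) : Prop :=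
  (∃ ρ : EdgeSeq m, IsCommonNielsen f g ρ ∧ ρ.HasHeight r) →
    ∃ (rf rg : ℤ) (β : EdgeSeq m),
      IsCommonNielsen f g β ∧ β.Below r ∧ G.IsPath (G.tgt r) β (G.tgt r) ∧
      f.onEdge r = (r, true) :: β.zpow rf ∧
      g.onEdge r = (r, true) :: β.zpow rg ∧
      (rf = 0 ∧ rg = 0 →
        IsCommonIndivisibleNielsen f g [(r, true)] ∧
        ∀ ρ : EdgeSeq m, IsCommonIndivisibleNielsen f g ρ → ρ.HasHeight r →
          ρ = [(r, true)] ∨ ρ = [(r, false)]) ∧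
      (¬ (rf = 0 ∧ rg = 0) →
        IsCommonIndivisibleNielsen f g ((r, true) :: β ++ [(r, false)]) ∧
        ∀ ρ : EdgeSeq m, IsCommonIndivisibleNielsen f g ρ → ρ.HasHeight r →
          ∃ k : ℤ, k ≠ 0 ∧ ρ = (r, true) :: β.zpow k ++ [(r, false)])

section NormalForm

variable {f g : GraphMap G G} (hf : f.IsUpperTriangular) (hg : g.IsUpperTriangular) {r : Fin m}
include hf hg

/-- Both maps fix E_r, so a common Nielsen path can be cut before and after each occurrence of E_r;
an indivisible one is that single edge. The trivial loop serves as β. -/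
theorem hasNormalForm_of_onEdge_eq_single (hfr : f.onEdge r = [(r, true)])
    (hgr : g.onEdge r = [(r, true)]) : HasNormalForm f g r := by
  have niff := fun {ρ : EdgeSeq m} => isCommonNielsen_iff (ρ := ρ) hf.1 hg.1
  have hfu : f.tail r = 1 := tail_of_onEdge hfr
  have hgu : g.tail r = 1 := tail_of_onEdge hgr
  have letter : ∀ (f : GraphMap G G), f.IsUpperTriangular → f.tail r = 1 → ∀ e : Fin m × Bool,
      e.1 = r → f.hom (FreeGroup.mk [e]) = FreeGroup.mk [e] := by
    rintro f hf h e he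
    rw [hf.isTriangular.map_letter, he, h]
    simp [preTail, postTail]
  intro _
  refine ⟨0, 0, [], ?_, by simp [EdgeSeq.Below], rfl, hfr, hgr, fun _ => ⟨⟨?_, by simp, ?_⟩, ?_⟩,
    fun h => absurd ⟨rfl, rfl⟩ h⟩
  · rw [niff, ← one_eq_mk]
    exact ⟨by simp, ⟨G.tgt r, G.tgt r, rfl⟩, _root_.map_one _, _root_.map_one _⟩
  · rw [niff]
    exact ⟨by simp, ⟨_, _, G.isPath_single (r, true)⟩, letter f hf hfu _ rfl,
      letter g hg hgu _ rfl⟩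
  · intro α β h _ _
    rcases List.append_eq_singleton_iff.1 h.symm with h | h
    · exact Or.inl h.1
    · exact Or.inr h.2
  · rintro ρ ⟨hρ, -, hind⟩ ⟨h1, h2⟩
    obtain ⟨A, e, B, rfl, hA, he⟩ := exists_split_first h2 h1
    obtain ⟨hred, ⟨a, b, hp⟩, hρf, hρg⟩ := niff.1 hρ
    have piece : ∀ f : GraphMap G G, f.IsUpperTriangular → f.tail r = 1 →
        f.hom (FreeGroup.mk (A ++ e :: B)) = FreeGroup.mk (A ++ e :: B) →
        f.hom (FreeGroup.mk A) = FreeGroup.mk A ∧ f.hom (FreeGroup.mk B) = FreeGroup.mk B := by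
      intro f hf h h'
      have := hf.isTriangular.split_of_map_eq hred h2 hA he (supported _).one_mem
        (supported _).one_mem (by simpa using h')
      rw [h] at this
      simpa [preTail, postTail] using this
    obtain ⟨hAf, hBf⟩ := piece f hf hfu hρf
    obtain ⟨hAg, hBg⟩ := piece g hg hgu hρg
    obtain ⟨c, hpA, hpe⟩ := FilteredGraph.isPath_append_iff.1 hp
    have hNA : IsCommonNielsen f g A := niff.2 ⟨hred.left, ⟨a, c, hpA⟩, hAf, hAg⟩
    have hNe : IsCommonNielsen f g (e :: B) := niff.2 ⟨hred.right, ⟨c, b, hpe⟩,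
      by rw [mk_cons, _root_.map_mul, letter f hf hfu e he, hBf],
      by rw [mk_cons, _root_.map_mul, letter g hg hgu e he, hBg]⟩
    obtain rfl : A = [] := (hind A (e :: B) rfl hNA hNe).resolve_right (by simp)
    have hN1 : IsCommonNielsen f g [e] := niff.2 ⟨by simp, ⟨_, _, G.isPath_single e⟩,
      letter f hf hfu e he, letter g hg hgu e he⟩
    have hN2 : IsCommonNielsen f g B := niff.2 ⟨IsReduced.right (L₁ := [e]) hred,
      ⟨_, b, hpe.2⟩, hBf, hBg⟩
    obtain rfl : B = [] := (hind [e] B rfl hN1 hN2).resolve_left (by simp)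
    rcases e with ⟨i, _ | _⟩
    · obtain rfl : i = r := he
      exact Or.inr rfl
    · obtain rfl : i = r := he
      exact Or.inl rfl

/-- A common Nielsen path of height `r` either is of the form `A E_r C Ē_r B` with its pieces
Nielsen, or contains a path `σ` such that `E_r σ` is Nielsen. -/
theorem exists_twisted_fixed {ρ : EdgeSeq m} (hρ : IsCommonNielsen f g ρ) (hr : ρ.HasHeight r) :
    (∃ (σ : EdgeSeq m) (d : V), G.IsPath (G.tgt r) σ d ∧ σ.Below r ∧
      f.tail r * f.hom (FreeGroup.mk σ) = FreeGroup.mk σ ∧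
      g.tail r * g.hom (FreeGroup.mk σ) = FreeGroup.mk σ) ∨
    ∃ A C B : EdgeSeq m, ρ = A ++ (r, true) :: (C ++ (r, false) :: B) ∧
      IsCommonNielsen f g A ∧ IsCommonNielsen f g ((r, true) :: (C ++ (r, false) :: B)) ∧
      IsCommonNielsen f g ((r, true) :: (C ++ [(r, false)])) ∧ IsCommonNielsen f g B ∧
      C ≠ [] ∧ IsReduced C ∧ C.Below r ∧ G.IsPath (G.tgt r) C (G.tgt r) ∧
      f.tail r * f.hom (FreeGroup.mk C) * (f.tail r)⁻¹ = FreeGroup.mk C ∧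
      g.tail r * g.hom (FreeGroup.mk C) * (g.tail r)⁻¹ = FreeGroup.mk C := by
  have niff := fun {ρ : EdgeSeq m} => isCommonNielsen_iff (ρ := ρ) hf.1 hg.1
  obtain ⟨h1, h2⟩ := hr
  obtain ⟨A, e, B₀, rfl, hA, he⟩ := exists_split_first h2 h1
  obtain ⟨hred, ⟨a, b, hp⟩, hρf, hρg⟩ := niff.1 hρ
  obtain ⟨hAf, hBf⟩ := hf.isTriangular.split_of_map_eq hred h2 hA he (supported _).one_mem
    (supported _).one_mem (by simpa using hρf)
  obtain ⟨hAg, hBg⟩ := hg.isTriangular.split_of_map_eq hred h2 hA he (supported _).one_mem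
    (supported _).one_mem (by simpa using hρg)
  obtain ⟨c, hpA, hpe⟩ := FilteredGraph.isPath_append_iff.1 hp
  rcases e with ⟨i, _ | _⟩
  · obtain rfl : i = r := he
    obtain rfl : c = G.tgt i := hpe.1
    refine Or.inl ⟨FreeGroup.invRev A, a, hpA.invRev, EdgeSeq.Below.invRev hA, ?_, ?_⟩
    · rw [mk_invRev, _root_.map_inv, ← inv_inj]
      simpa [preTail] using hAf
    · rw [mk_invRev, _root_.map_inv, ← inv_inj]
      simpa [preTail] using hAg
  obtain rfl : i = r := he
  have hpB : G.IsPath (G.tgt i) B₀ b := hpe.2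
  simp only [preTail, postTail, if_true, one_mul, mul_one] at hAf hAg hBf hBg
  rcases lt_or_exists_eq (r := i) (L := B₀) (fun x hx => h2 x (by simp [hx])) with hB | hB
  · exact Or.inl ⟨B₀, b, hpB, hB, hBf, hBg⟩
  obtain ⟨C, e, B, rfl, hC, he⟩ := exists_split_first (fun x hx => h2 x (by simp [hx])) hB
  have hred' : IsReduced (C ++ e :: B) := IsReduced.right (L₁ := A ++ [(i, true)])
    (by simpa using hred)
  obtain ⟨hCf, hBf'⟩ := hf.isTriangular.split_of_map_eq hred'
    (fun x hx => h2 x (List.mem_append_right _ (List.mem_cons_of_mem _ hx))) hC he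
    (hf.isTriangular i).2 (supported _).one_mem (by rw [mul_one]; exact hBf)
  obtain ⟨hCg, hBg'⟩ := hg.isTriangular.split_of_map_eq hred'
    (fun x hx => h2 x (List.mem_append_right _ (List.mem_cons_of_mem _ hx))) hC he
    (hg.isTriangular i).2 (supported _).one_mem (by rw [mul_one]; exact hBg)
  obtain ⟨d, hpC, hpe'⟩ := FilteredGraph.isPath_append_iff.1 hpB
  -- The next occurrence of E_r decides: crossed backwards, it closes up a twisted fixed loop `C`;
  -- crossed forwards, it has no tail in front, and `C` is already a twisted fixed path.
  rcases e with ⟨j, _ | _⟩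
  · obtain rfl : j = i := he
    obtain rfl : d = G.tgt j := hpe'.1
    simp only [preTail, postTail, Bool.false_eq_true, if_false, one_mul, mul_one]
      at hCf hCg hBf' hBg'
    have hC0 : C ≠ [] := by
      rintro rfl
      have : IsReduced ((j, true) :: (j, false) :: B) := IsReduced.right (L₁ := A)
        (by simpa using hred)
      have := (isReduced_cons_cons.1 this).1 rfl
      simp at this
    have fixE : ∀ f : GraphMap G G, f.IsUpperTriangular → ∀ L : EdgeSeq m,
        f.tail j * f.hom (FreeGroup.mk L) = FreeGroup.mk L →
        f.hom (FreeGroup.mk ((j, true) :: L)) = FreeGroup.mk ((j, true) :: L) := by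
      intro f hf L h
      rw [mk_cons, _root_.map_mul, hf.isTriangular.map_letter]
      nth_rw 2 [← h]
      simp [preTail, postTail, mul_assoc]
    have fixC : ∀ f : GraphMap G G, f.IsUpperTriangular →
        f.tail j * f.hom (FreeGroup.mk C) * (f.tail j)⁻¹ = FreeGroup.mk C →
        f.tail j * f.hom (FreeGroup.mk (C ++ [(j, false)])) =
          FreeGroup.mk (C ++ [(j, false)]) := by
      intro f hf h
      rw [mk_append, _root_.map_mul, hf.isTriangular.map_letter]
      nth_rw 2 [← h]
      simp [preTail, postTail, mul_assoc]
    have hE : G.IsPath (G.src j) ((j, true) :: (C ++ (j, false) :: B)) b := ⟨rfl, hpB⟩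
    have hE' : G.IsPath (G.src j) ((j, true) :: (C ++ [(j, false)])) (G.src j) :=
      ⟨rfl, hpC.append (G.isPath_single (j, false))⟩
    refine Or.inr ⟨A, C, B, rfl, niff.2 ⟨hred.left, ⟨a, c, hpA⟩, hAf, hAg⟩,
      niff.2 ⟨hred.right, ⟨_, _, hE⟩, fixE f hf _ hBf, fixE g hg _ hBg⟩,
      niff.2 ⟨?_, ⟨_, _, hE'⟩, fixE f hf _ (fixC f hf hCf), fixE g hg _ (fixC g hg hCg)⟩,
      niff.2 ⟨?_, ⟨_, _, hpe'.2⟩, hBf', hBg'⟩, hC0, hred'.left, hC, hpC, hCf, hCg⟩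
    · exact IsReduced.left (L₂ := B) (by simpa using hred.right)
    · exact IsReduced.right (L₁ := C ++ [(j, false)]) (by simpa using hred')
  · obtain rfl : j = i := he
    simp only [preTail, if_true, mul_one] at hCf hCg
    exact Or.inl ⟨C, d, hpC, hC, hCf, hCg⟩

/-- A proper cut of E_r β Ē_r would leave a Nielsen piece E_r γ₁ with γ₁ a common twisted fixed
path, against `hno`. Any other INP of height r reduces to E_r C Ē_r with C a twisted fixed loop,
which `hcent` makes a power of β. -/
theorem hasNormalForm_of_zpow {β : EdgeSeq m} {a b : ℤ} (hβr : β.Below r)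
    (hβp : G.IsPath (G.tgt r) β (G.tgt r)) (hβne : β ≠ []) (hβc : IsCyclicallyReduced β)
    (hβf : f.hom (FreeGroup.mk β) = FreeGroup.mk β)
    (hβg : g.hom (FreeGroup.mk β) = FreeGroup.mk β)
    (hfr : f.onEdge r = (r, true) :: β.zpow a) (hgr : g.onEdge r = (r, true) :: β.zpow b)
    (hno : ∀ (σ : EdgeSeq m) (d : V), G.IsPath (G.tgt r) σ d → σ.Below r →
      ¬ (FreeGroup.mk β ^ a * f.hom (FreeGroup.mk σ) = FreeGroup.mk σ ∧
        FreeGroup.mk β ^ b * g.hom (FreeGroup.mk σ) = FreeGroup.mk σ))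
    (hcent : ∀ γ : EdgeSeq m, IsReduced γ → G.IsPath (G.tgt r) γ (G.tgt r) → γ.Below r →
      FreeGroup.mk β ^ a * f.hom (FreeGroup.mk γ) * (FreeGroup.mk β ^ a)⁻¹ = FreeGroup.mk γ →
      FreeGroup.mk β ^ b * g.hom (FreeGroup.mk γ) * (FreeGroup.mk β ^ b)⁻¹ = FreeGroup.mk γ →
      ∃ k : ℤ, FreeGroup.mk γ = FreeGroup.mk β ^ k) : HasNormalForm f g r := by
  have niff := fun {ρ : EdgeSeq m} => isCommonNielsen_iff (ρ := ρ) hf.1 hg.1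
  have hfu : f.tail r = FreeGroup.mk β ^ a := by rw [tail_of_onEdge hfr, EdgeSeq.mk_zpow]
  have hgu : g.tail r = FreeGroup.mk β ^ b := by rw [tail_of_onEdge hgr, EdgeSeq.mk_zpow]
  have hab : ¬ (a = 0 ∧ b = 0) := by
    rintro ⟨rfl, rfl⟩
    exact hno [] _ rfl (by simp [EdgeSeq.Below]) (by simp [← one_eq_mk])
  intro _
  refine ⟨a, b, β, niff.2 ⟨hβc.1, ⟨_, _, hβp⟩, hβf, hβg⟩, hβr, hβp, hfr, hgr,
    fun h => absurd h hab, fun _ => ⟨⟨niff.2 ⟨?_, ?_, ?_, ?_⟩, by simp, ?_⟩, ?_⟩⟩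
  · obtain ⟨x, β', rfl⟩ := List.exists_cons_of_ne_nil hβne
    have h1 : IsReduced ((r, true) :: (x :: β')) := by
      rw [isReduced_cons_cons]
      exact ⟨fun h => absurd h.symm (ne_of_lt (hβr x (by simp))), hβc.1⟩
    have h2 : IsReduced ((x :: β') ++ [(r, false)]) :=
      isReduced_append_cons hβc.1 (by simp) fun y hy => ne_of_lt (hβr y hy)
    exact IsReduced.append_overlap (L₁ := [(r, true)]) h1 h2 hβne
  · exact ⟨_, _, rfl, hβp.append (G.isPath_single (r, false))⟩
  · have : (r, true) :: β ++ [(r, false)] = [(r, true)] ++ β ++ [(r, false)] := by simp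
    rw [this, mk_append, mk_append, _root_.map_mul, _root_.map_mul, hβf,
      hf.isTriangular.map_letter, hf.isTriangular.map_letter, hfu]
    simp only [preTail, postTail, if_true, Bool.false_eq_true, if_false, one_mul, mul_one]
    group
  · have : (r, true) :: β ++ [(r, false)] = [(r, true)] ++ β ++ [(r, false)] := by simp
    rw [this, mk_append, mk_append, _root_.map_mul, _root_.map_mul, hβg,
      hg.isTriangular.map_letter, hg.isTriangular.map_letter, hgu]
    simp only [preTail, postTail, if_true, Bool.false_eq_true, if_false, one_mul, mul_one]
    group
  · intro γ₁ γ₂ h h₁ h₂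
    by_contra! hne
    obtain ⟨x, γ₁, rfl⟩ := List.exists_cons_of_ne_nil hne.1
    simp only [List.cons_append, List.cons.injEq] at h
    obtain ⟨rfl, h⟩ := h
    obtain ⟨γ₂, y, rfl⟩ : ∃ L y, γ₂ = L ++ [y] :=
      ⟨_, _, (List.dropLast_append_getLast hne.2).symm⟩
    rw [← List.append_assoc] at h
    obtain ⟨rfl, -⟩ := List.append_inj' h rfl
    obtain ⟨d, hd, -⟩ := FilteredGraph.isPath_append_iff.1 hβp
    obtain ⟨-, -, h3, h4⟩ := niff.1 h₁
    have unfix : ∀ f : GraphMap G G, f.IsUpperTriangular →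
        f.hom (FreeGroup.mk ((r, true) :: γ₁)) = FreeGroup.mk ((r, true) :: γ₁) →
        f.tail r * f.hom (FreeGroup.mk γ₁) = FreeGroup.mk γ₁ := by
      intro f hf h
      rw [mk_cons, _root_.map_mul, hf.isTriangular.map_letter] at h
      simp only [preTail, postTail, if_true, one_mul, mul_assoc] at h
      exact mul_left_cancel h
    refine hno γ₁ d hd (fun z hz => hβr z (by simp [hz])) ⟨?_, ?_⟩
    · rw [← hfu]; exact unfix f hf h3
    · rw [← hgu]; exact unfix g hg h4
  · rintro ρ ⟨hρ, -, hind⟩ hht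
    rcases exists_twisted_fixed hf hg hρ hht with ⟨σ, d, h1, h2, h3, h4⟩ |
      ⟨A, C, B, rfl, hNA, hNE, hNC, hNB, hC0, hCred, hCr, hCp, hCf, hCg⟩
    · rw [hfu] at h3
      rw [hgu] at h4
      exact (hno σ d h1 h2 ⟨h3, h4⟩).elim
    · obtain rfl : A = [] := (hind A _ rfl hNA hNE).resolve_right (by simp)
      obtain rfl : B = [] := (hind ((r, true) :: (C ++ [(r, false)])) B (by simp) hNC
        hNB).resolve_left (by simp)
      rw [hfu] at hCf
      rw [hgu] at hCg
      obtain ⟨k, hk⟩ := hcent C hCred hCp hCr hCf hCg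
      rw [← EdgeSeq.mk_zpow] at hk
      -- Powers of the cyclically reduced β are reduced, so equality in the free group is equality
      -- of edge paths.
      obtain rfl := hCred.mk_injective (EdgeSeq.isReduced_zpow hβc k) hk
      refine ⟨k, ?_, by simp⟩
      rintro rfl
      exact hC0 rfl

end NormalForm

end GraphMap

/-! ### Independence of the normal form from higher edges. -/

theorem FreeGroup.eqOn_supported {α H : Type*} [DecidableEq α] [Group H]
    {φ ψ : FreeGroup α →* H} {S : Set α} (h : ∀ i ∈ S, φ (of i) = ψ (of i)) {w : FreeGroup α}
    (hw : w ∈ supported S) : φ w = ψ w :=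
  mem_of_supported (K := φ.eqLocus ψ) h hw

namespace FilteredGraph

variable {V : Type u} {m : ℕ}

theorem IsPath.of_eqOn {G G₂ : FilteredGraph V m} {S : Set (Fin m)}
    (hG : ∀ i ∈ S, G.src i = G₂.src i ∧ G.tgt i = G₂.tgt i) {a b : V} {α : EdgeSeq m}
    (hα : ∀ e ∈ α, e.1 ∈ S) (h : G.IsPath a α b) : G₂.IsPath a α b := by
  induction α generalizing a with
  | nil => exact h
  | cons e α ih =>
    obtain ⟨h1, h2⟩ := hG e.1 (hα e (by simp))
    have hi : G.initial e = G₂.initial e := by simp [initial, h1, h2]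
    have ht : G.terminal e = G₂.terminal e := by simp [terminal, h1, h2]
    exact ⟨hi ▸ h.1, ht ▸ ih (fun x hx => hα x (by simp [hx])) h.2⟩

end FilteredGraph

namespace GraphMap

variable {V : Type u} {W : Type v} {m n : ℕ}

theorem onPath_append {G : FilteredGraph V m} {H : FilteredGraph W n} (p : GraphMap G H)
    (α β : EdgeSeq m) : p.onPath (α ++ β) = p.onPath α ++ p.onPath β := by
  simp [onPath]

section Transfer

variable {G G₂ : FilteredGraph V m} {f g : GraphMap G G} {f₂ g₂ : GraphMap G₂ G₂} {r : Fin m}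

/-- Normal forms at `E_r` only depend on the edges up to `E_r`. -/
theorem HasNormalForm.of_eqOn (hf : ∀ a, f.onVert a = a) (hg : ∀ a, g.onVert a = a)
    (hf₂ : ∀ a, f₂.onVert a = a) (hg₂ : ∀ a, g₂.onVert a = a)
    (hG : ∀ i ≤ r, G.src i = G₂.src i ∧ G.tgt i = G₂.tgt i)
    (hff : ∀ i ≤ r, f.onEdge i = f₂.onEdge i) (hgg : ∀ i ≤ r, g.onEdge i = g₂.onEdge i)
    (h : HasNormalForm f g r) : HasNormalForm f₂ g₂ r := by
  have homEq : ∀ {f : GraphMap G G} {f₂ : GraphMap G₂ G₂}, (∀ i ≤ r, f.onEdge i = f₂.onEdge i) →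
      ∀ ρ : EdgeSeq m, (∀ e ∈ ρ, e.1 ≤ r) →
      f.hom (FreeGroup.mk ρ) = f₂.hom (FreeGroup.mk ρ) := by
    intro f f₂ hff ρ hρ
    refine eqOn_supported (S := Set.Iic r) (fun i hi => ?_) (mk_mem_supported hρ)
    rw [hom_of, hom_of, hff i hi]
  have nielsen : ∀ ρ : EdgeSeq m, (∀ e ∈ ρ, e.1 ≤ r) →
      (IsCommonNielsen f g ρ ↔ IsCommonNielsen f₂ g₂ ρ) := by
    intro ρ hρ
    rw [isCommonNielsen_iff hf hg, isCommonNielsen_iff hf₂ hg₂, homEq hff ρ hρ, homEq hgg ρ hρ]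
    refine and_congr_right fun _ => and_congr_left fun _ => ?_
    exact ⟨fun ⟨a, b, h⟩ => ⟨a, b, h.of_eqOn (S := Set.Iic r) hG hρ⟩,
      fun ⟨a, b, h⟩ => ⟨a, b, h.of_eqOn (S := Set.Iic r)
        (fun i hi => ⟨(hG i hi).1.symm, (hG i hi).2.symm⟩) hρ⟩⟩
  have inp : ∀ ρ : EdgeSeq m, (∀ e ∈ ρ, e.1 ≤ r) →
      (IsCommonIndivisibleNielsen f g ρ ↔ IsCommonIndivisibleNielsen f₂ g₂ ρ) := by
    intro ρ hρ
    rw [IsCommonIndivisibleNielsen, IsCommonIndivisibleNielsen, nielsen ρ hρ]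
    refine and_congr_right fun _ => and_congr_right fun _ => ?_
    refine forall_congr' fun α => forall_congr' fun β => forall_congr' fun hαβ => ?_
    subst hαβ
    rw [nielsen α fun e he => hρ e (by simp [he]), nielsen β fun e he => hρ e (by simp [he])]
  rintro ⟨ρ, hρ, hht⟩
  obtain ⟨rf, rg, β, h1, h2, h3, h4, h5, h6, h7⟩ := h ⟨ρ, (nielsen ρ hht.2).2 hρ, hht⟩
  have hβ : ∀ e ∈ β, e.1 ≤ r := fun e he => le_of_lt (h2 e he)
  refine ⟨rf, rg, β, (nielsen β hβ).1 h1, h2, ?_, (hff r le_rfl) ▸ h4, (hgg r le_rfl) ▸ h5,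
    fun h0 => ⟨?_, ?_⟩, fun h0 => ⟨?_, ?_⟩⟩
  · rw [← (hG r le_rfl).2]; exact h3.of_eqOn (S := Set.Iic r) hG hβ
  · exact (inp _ (by simp)).1 (h6 h0).1
  · exact fun ρ hρ hht => (h6 h0).2 ρ ((inp ρ hht.2).2 hρ) hht
  · refine (inp _ fun e he => ?_).1 (h7 h0).1
    simp only [List.cons_append, List.mem_cons, List.mem_append, List.not_mem_nil, or_false] at he
    rcases he with rfl | he | rfl
    · exact le_rfl
    · exact hβ e he
    · exact le_rfl
  · exact fun ρ hρ hht => (h7 h0).2 ρ ((inp ρ hht.2).2 hρ) hht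

end Transfer

end GraphMap

/-! ### Sliding an edge. -/

namespace FilteredGraph

variable {V : Type u} {m : ℕ} (G : FilteredGraph V m) (r : Fin m) (δ : EdgeSeq m) (c : V)
  (hδ : G.IsPath (G.tgt r) δ c) (hr : δ.Below r)

theorem slide_tgt_self : (G.slide r c).tgt r = c := by simp [slide]

theorem slide_tgt_of_ne {i : Fin m} (h : i ≠ r) : (G.slide r c).tgt i = G.tgt i := by
  simp [slide, h]

theorem slideMap_hom_of_self :
    (G.slideMap r δ c hδ hr).hom (FreeGroup.of r) = FreeGroup.of r * (FreeGroup.mk δ)⁻¹ := by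
  rw [GraphMap.hom_of]
  simp only [slideMap, if_true]
  rw [mk_cons, mk_invRev]; rfl

theorem slideMap_hom_of_ne {i : Fin m} (h : i ≠ r) :
    (G.slideMap r δ c hδ hr).hom (FreeGroup.of i) = FreeGroup.of i := by
  rw [GraphMap.hom_of]
  simp only [slideMap, if_neg h]
  rfl

theorem slideMap_hom_of_mem {x : FreeGroup (Fin m)} (h : x ∈ supported (Set.Iio r)) :
    (G.slideMap r δ c hδ hr).hom x = x :=
  eqOn_supported (ψ := MonoidHom.id _) (fun _ hi => G.slideMap_hom_of_ne r δ c hδ hr (ne_of_lt hi))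
    h

theorem slideMap_onPath_of_below {α : EdgeSeq m} (h : α.Below r) :
    (G.slideMap r δ c hδ hr).onPath α = α := by
  induction α with
  | nil => rfl
  | cons e α ih =>
    have he : e.1 ≠ r := ne_of_lt (h e (by simp))
    have h1 : (G.slideMap r δ c hδ hr).onPath (e :: α) =
        (if e.2 then (G.slideMap r δ c hδ hr).onEdge e.1 else
          FreeGroup.invRev ((G.slideMap r δ c hδ hr).onEdge e.1)) ++
        (G.slideMap r δ c hδ hr).onPath α := rfl
    rw [h1, ih fun x hx => h x (by simp [hx])]
    rcases e with ⟨i, _ | _⟩ <;> simp [slideMap, he, FreeGroup.invRev]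

theorem slideMap_onPath_below {i : Fin m} {α : EdgeSeq m} (h : α.Below i) :
    ((G.slideMap r δ c hδ hr).onPath α).Below i := by
  have hE : ∀ j < i, ((G.slideMap r δ c hδ hr).onEdge j).Below i := by
    intro j hj
    by_cases hjr : j = r
    · subst hjr
      intro e he
      simp only [slideMap, if_true, List.mem_cons] at he
      rcases he with rfl | he
      · exact hj
      · exact (EdgeSeq.Below.invRev hr e he).trans hj
    · intro e he
      simp only [slideMap, if_neg hjr, List.mem_singleton] at he
      rw [he]; exact hj
  intro e he
  obtain ⟨x, hx, hxe⟩ := List.mem_flatMap.1 he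
  have h1 := hE x.1 (h x hx)
  split_ifs at hxe
  · exact h1 e hxe
  · exact h1.invRev e hxe

/-- Sliding back. -/
theorem exists_slideMap_inverse : ∃ q : GraphMap (G.slide r c) G, (∀ a, q.onVert a = a) ∧
    q.hom.comp (G.slideMap r δ c hδ hr).hom = MonoidHom.id _ ∧
    (G.slideMap r δ c hδ hr).hom.comp q.hom = MonoidHom.id _ := by
  let q : GraphMap (G.slide r c) G :=
    { onVert := fun a => a
      onEdge := fun i => if i = r then (r, true) :: δ else [(i, true)]
      isPath_onEdge := fun i => by
        by_cases h : i = r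
        · subst h
          simp only [if_true]
          rw [slide_tgt_self]
          exact ⟨rfl, hδ⟩
        · simp only [if_neg h]
          rw [slide_tgt_of_ne G r c h]
          exact G.isPath_single (i, true) }
  have hqr : q.hom (FreeGroup.of r) = FreeGroup.of r * FreeGroup.mk δ := by
    rw [GraphMap.hom_of]
    simp only [q, if_true]
    rw [mk_cons]; rfl
  have hqi : ∀ i, i ≠ r → q.hom (FreeGroup.of i) = FreeGroup.of i := by
    intro i h
    rw [GraphMap.hom_of]
    simp only [q, if_neg h]; rfl
  have hδm : FreeGroup.mk δ ∈ supported (Set.Iio r) := mk_mem_supported hr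
  have hqδ : q.hom (FreeGroup.mk δ) = FreeGroup.mk δ :=
    eqOn_supported (ψ := MonoidHom.id _) (fun i hi => hqi i (ne_of_lt hi)) hδm
  refine ⟨q, fun _ => rfl, FreeGroup.ext_hom _ _ fun i => ?_, FreeGroup.ext_hom _ _ fun i => ?_⟩
  · by_cases h : i = r
    · subst h
      rw [MonoidHom.comp_apply, slideMap_hom_of_self, _root_.map_mul, _root_.map_inv, hqr, hqδ]
      exact mul_inv_cancel_right _ _
    · rw [MonoidHom.comp_apply, G.slideMap_hom_of_ne r δ c hδ hr h, hqi i h]; rfl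
  · by_cases h : i = r
    · subst h
      rw [MonoidHom.comp_apply, hqr, _root_.map_mul, slideMap_hom_of_self,
        G.slideMap_hom_of_mem i δ c hδ hr hδm]
      exact inv_mul_cancel_right _ _
    · rw [MonoidHom.comp_apply, hqi i h, G.slideMap_hom_of_ne r δ c hδ hr h]; rfl

/-- The map on the new graph after sliding `E_r` along `δ`, with `E_r` sent to `E_r υ`. -/
def slideConj (f : GraphMap G G) (hf : ∀ a, f.onVert a = a) (υ : EdgeSeq m)
    (hυ : G.IsPath c υ c) (hυr : υ.Below r) : GraphMap (G.slide r c) (G.slide r c) where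
  onVert a := a
  onEdge i := if i = r then (r, true) :: υ else (G.slideMap r δ c hδ hr).onPath (f.onEdge i)
  isPath_onEdge i := by
    by_cases h : i = r
    · subst h
      simp only [if_true]
      have : (G.slide i c).terminal (i, true) = c := by simp [terminal, slide]
      refine ⟨rfl, ?_⟩
      rw [slide_tgt_self, this]
      exact hυ.slide c hυr
    · simp only [if_neg h]
      rw [slide_tgt_of_ne G r c h]
      have := (G.slideMap r δ c hδ hr).isPath_onPath (f.isPath_onEdge i)
      rwa [hf, hf] at this

section slideConj

variable (f : GraphMap G G) (hf : f.IsUpperTriangular) (υ : EdgeSeq m)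
    (hυ : G.IsPath c υ c) (hυr : υ.Below r)

theorem slideConj_onEdge_self :
    (G.slideConj r δ c hδ hr f hf.1 υ hυ hυr).onEdge r = (r, true) :: υ := by
  simp [slideConj]

theorem slideConj_onEdge_of_ne {i : Fin m} (h : i ≠ r) :
    (G.slideConj r δ c hδ hr f hf.1 υ hυ hυr).onEdge i =
      (G.slideMap r δ c hδ hr).onPath (f.onEdge i) := by
  simp [slideConj, h]

theorem slideConj_onEdge_of_lt {i : Fin m} (h : i < r) :
    (G.slideConj r δ c hδ hr f hf.1 υ hυ hυr).onEdge i = f.onEdge i := by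
  rw [slideConj_onEdge_of_ne _ _ _ _ _ _ _ hf _ _ _ (ne_of_lt h), slideMap_onPath_of_below]
  obtain ⟨α, -, h1, h2⟩ := hf.2 i
  rw [h2]
  intro e he
  rcases List.mem_cons.1 he with rfl | he
  · exact h
  · exact (h1 e he).trans h

theorem isUpperTriangular_slideConj :
    (G.slideConj r δ c hδ hr f hf.1 υ hυ hυr).IsUpperTriangular := by
  refine ⟨fun _ => rfl, fun i => ?_⟩
  by_cases h : i = r
  · subst h
    refine ⟨υ, ?_, hυr, slideConj_onEdge_self _ _ _ _ _ _ _ hf _ _ _⟩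
    rw [slide_tgt_self]
    exact hυ.slide c hυr
  · obtain ⟨α, h1, h2, h3⟩ := hf.2 i
    refine ⟨(G.slideMap r δ c hδ hr).onPath α, ?_, G.slideMap_onPath_below r δ c hδ hr h2, ?_⟩
    · rw [slide_tgt_of_ne G r c h]
      exact (G.slideMap r δ c hδ hr).isPath_onPath h1
    · rw [slideConj_onEdge_of_ne _ _ _ _ _ _ _ hf _ _ _ h, h3,
        ← List.singleton_append, GraphMap.onPath_append]
      simp [GraphMap.onPath, slideMap, h]

theorem slideConj_hom_of_mem {x : FreeGroup (Fin m)} (h : x ∈ supported (Set.Iio r)) :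
    (G.slideConj r δ c hδ hr f hf.1 υ hυ hυr).hom x = f.hom x := by
  refine eqOn_supported (fun i hi => ?_) h
  rw [GraphMap.hom_of, GraphMap.hom_of, slideConj_onEdge_of_lt _ _ _ _ _ _ _ hf _ _ _ hi]

/-- On E_r the two sides are E_r υ f(δ)⁻¹ and E_r δ⁻¹ u_r, since nothing changes below r; the
hypothesis on υ is exactly their equality. -/
theorem slideConj_hom_comp (h : FreeGroup.mk υ =
      (FreeGroup.mk δ)⁻¹ * f.tail r * f.hom (FreeGroup.mk δ)) :
    (G.slideConj r δ c hδ hr f hf.1 υ hυ hυr).hom.comp (G.slideMap r δ c hδ hr).hom =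
      (G.slideMap r δ c hδ hr).hom.comp f.hom := by
  refine FreeGroup.ext_hom _ _ fun i => ?_
  rw [MonoidHom.comp_apply, MonoidHom.comp_apply]
  by_cases hi : i = r
  · subst hi
    have htri := hf.isTriangular i
    rw [slideMap_hom_of_self, _root_.map_mul, _root_.map_inv,
      G.slideConj_hom_of_mem i δ c hδ hr f hf υ hυ hυr (mk_mem_supported hr), htri.1,
      _root_.map_mul, slideMap_hom_of_self, G.slideMap_hom_of_mem i δ c hδ hr htri.2,
      GraphMap.hom_of, slideConj_onEdge_self _ _ _ _ _ _ _ hf, mk_cons, h]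
    simp only [FreeGroup.of]
    group
  · rw [G.slideMap_hom_of_ne r δ c hδ hr hi, GraphMap.hom_of,
      slideConj_onEdge_of_ne _ _ _ _ _ _ _ hf _ _ _ hi, GraphMap.mk_onPath, GraphMap.hom_of]

end slideConj

/-- One slide puts a pair of upper triangular maps into normal form at `E_r`. -/
theorem exists_slide_hasNormalForm (f g : GraphMap G G) (hf : f.IsUpperTriangular)
    (hg : g.IsUpperTriangular) (r : Fin m) (hρ : ∃ ρ : EdgeSeq m,
      GraphMap.IsCommonNielsen f g ρ ∧ ρ.HasHeight r) :
    ∃ (δ : EdgeSeq m) (c : V) (hδ : G.IsPath (G.tgt r) δ c) (hr : δ.Below r) (υ ν : EdgeSeq m)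
      (hυ : G.IsPath c υ c) (hυr : υ.Below r) (hν : G.IsPath c ν c) (hνr : ν.Below r),
      FreeGroup.mk υ = (FreeGroup.mk δ)⁻¹ * f.tail r * f.hom (FreeGroup.mk δ) ∧
      FreeGroup.mk ν = (FreeGroup.mk δ)⁻¹ * g.tail r * g.hom (FreeGroup.mk δ) ∧
      GraphMap.HasNormalForm (G.slideConj r δ c hδ hr f hf.1 υ hυ hυr)
        (G.slideConj r δ c hδ hr g hg.1 ν hν hνr) r := by
  obtain ⟨ρ, hρ, hht⟩ := hρ
  by_cases hno : ∃ (σ : EdgeSeq m) (d : V), G.IsPath (G.tgt r) σ d ∧ σ.Below r ∧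
      f.tail r * f.hom (FreeGroup.mk σ) = FreeGroup.mk σ ∧
      g.tail r * g.hom (FreeGroup.mk σ) = FreeGroup.mk σ
  · obtain ⟨σ, d, h1, h2, h3, h4⟩ := hno
    have hnil : EdgeSeq.Below ([] : EdgeSeq m) r := by simp [EdgeSeq.Below]
    -- Sliding along σ turns both tails into σ⁻¹σ, so E_r becomes fixed by both maps.
    refine ⟨σ, d, h1, h2, [], [], rfl, hnil, rfl, hnil, ?_, ?_, ?_⟩
    · rw [mul_assoc, h3, inv_mul_cancel]; rfl
    · rw [mul_assoc, h4, inv_mul_cancel]; rfl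
    · exact GraphMap.hasNormalForm_of_onEdge_eq_single
        (G.isUpperTriangular_slideConj r σ d h1 h2 f hf [] rfl hnil)
        (G.isUpperTriangular_slideConj r σ d h1 h2 g hg [] rfl hnil)
        (slideConj_onEdge_self _ _ _ _ _ _ _ hf _ _ _)
        (slideConj_onEdge_self _ _ _ _ _ _ _ hg _ _ _)
  · rcases GraphMap.exists_twisted_fixed hf hg hρ hht with h |
      ⟨-, C, -, -, -, -, -, -, hC0, hCred, hCr, hCp, hCf, hCg⟩
    · exact absurd h hno
    obtain ⟨δ, β, c, a, b, hδ, hr, hβp, hβr, hβne, hβc, hβf, hβg, ha, hb, hno', hcent⟩ :=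
      exists_root_of_twisted_fixed hf.isTriangular hg.isTriangular
        (fun σ d h1 h2 h3 => hno ⟨σ, d, h1, h2, h3.1, h3.2⟩) hCred hC0 hCp hCr hCf hCg
    refine ⟨δ, c, hδ, hr, β.zpow a, β.zpow b, hβp.zpow a, hβr.zpow a, hβp.zpow b, hβr.zpow b,
      by rw [EdgeSeq.mk_zpow, ha], by rw [EdgeSeq.mk_zpow, hb], ?_⟩
    have hF : ∀ α : EdgeSeq m, α.Below r →
        (G.slideConj r δ c hδ hr f hf.1 (β.zpow a) (hβp.zpow a) (hβr.zpow a)).hom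
          (FreeGroup.mk α) = f.hom (FreeGroup.mk α) := fun α hα =>
      slideConj_hom_of_mem _ _ _ _ _ _ _ hf _ _ _ (mk_mem_supported hα)
    have hH : ∀ α : EdgeSeq m, α.Below r →
        (G.slideConj r δ c hδ hr g hg.1 (β.zpow b) (hβp.zpow b) (hβr.zpow b)).hom
          (FreeGroup.mk α) = g.hom (FreeGroup.mk α) := fun α hα =>
      slideConj_hom_of_mem _ _ _ _ _ _ _ hg _ _ _ (mk_mem_supported hα)
    have hpath : ∀ {a b : V} {α : EdgeSeq m}, α.Below r → (G.slide r c).IsPath a α b →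
        G.IsPath a α b := fun hα h => IsPath.of_eqOn (G := G.slide r c) (G₂ := G)
      (S := Set.Iio r) (fun i hi => ⟨rfl, slide_tgt_of_ne G r c (ne_of_lt hi)⟩) hα h
    refine GraphMap.hasNormalForm_of_zpow
      (G.isUpperTriangular_slideConj r δ c hδ hr f hf _ _ _)
      (G.isUpperTriangular_slideConj r δ c hδ hr g hg _ _ _) hβr
      (by rw [slide_tgt_self]; exact hβp.slide c hβr) hβne hβc
      (by rw [hF β hβr, hβf]) (by rw [hH β hβr, hβg])
      (slideConj_onEdge_self _ _ _ _ _ _ _ hf _ _ _)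
      (slideConj_onEdge_self _ _ _ _ _ _ _ hg _ _ _) ?_ ?_
    · intro σ d h1 h2
      rw [slide_tgt_self] at h1
      rw [hF σ h2, hH σ h2]
      exact hno' σ d (hpath h2 h1) h2
    · intro γ h1 h2 h3
      rw [slide_tgt_self] at h2
      rw [hF γ h3, hH γ h3]
      exact hcent γ h1 (hpath h3 h2) h3

end FilteredGraph

/-! ### Induction over the edges and the theorem. -/

open GraphMap in
/-- Sliding the edges one after the other puts all of the first `k` edges in normal form. -/
theorem exists_slideComposite_hasNormalForm {V : Type u} {m : ℕ} (G' : FilteredGraph V m)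
    (f' g' : GraphMap G' G') (hf' : f'.IsUpperTriangular) (hg' : g'.IsUpperTriangular) (k : ℕ)
    (hk : k ≤ m) :
    ∃ (G : FilteredGraph V m) (f g : GraphMap G G) (τ : GraphMap G' G) (q : GraphMap G G'),
      f.IsUpperTriangular ∧ g.IsUpperTriangular ∧ IsSlideComposite G' G τ ∧
      (∀ a, τ.onVert a = a) ∧ (∀ a, q.onVert a = a) ∧
      q.hom.comp τ.hom = MonoidHom.id _ ∧ τ.hom.comp q.hom = MonoidHom.id _ ∧
      f.hom.comp τ.hom = τ.hom.comp f'.hom ∧ g.hom.comp τ.hom = τ.hom.comp g'.hom ∧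
      ∀ r : Fin m, r.val < k → HasNormalForm f g r := by
  induction k with
  | zero =>
    refine ⟨G', f', g', GraphMap.id G', GraphMap.id G', hf', hg', .refl, fun _ => rfl,
      fun _ => rfl, ?_, ?_, ?_, ?_, fun r hr => absurd hr (by omega)⟩ <;>
    rw [hom_id] <;> rfl
  | succ k ih =>
    obtain ⟨G, f, g, τ, q, hf, hg, hτ, hτv, hqv, hqτ, hτq, hfτ, hgτ, hnf⟩ := ih (by omega)
    let r : Fin m := ⟨k, hk⟩
    -- Without a common Nielsen path of this height the normal form holds vacuously and no slide is
    -- needed.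
    by_cases hρ : ∃ ρ : EdgeSeq m, IsCommonNielsen f g ρ ∧ ρ.HasHeight r
    · obtain ⟨δ, c, hδ, hr, υ, ν, hυ, hυr, hν, hνr, hυe, hνe, hn⟩ :=
        G.exists_slide_hasNormalForm f g hf hg r hρ
      obtain ⟨p, hpv, hp1, hp2⟩ := G.exists_slideMap_inverse r δ c hδ hr
      have hf₂ := G.isUpperTriangular_slideConj r δ c hδ hr f hf υ hυ hυr
      have hg₂ := G.isUpperTriangular_slideConj r δ c hδ hr g hg ν hν hνr
      refine ⟨G.slide r c, _, _, (G.slideMap r δ c hδ hr).comp τ, q.comp p, hf₂, hg₂,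
        .step G τ r δ c hδ hr hτ, hτv, ?_, ?_, ?_, ?_, ?_, ?_⟩
      · intro a
        change q.onVert (p.onVert a) = a
        rw [hpv, hqv]
      · rw [hom_comp, hom_comp, MonoidHom.comp_assoc, ← MonoidHom.comp_assoc τ.hom _ p.hom, hp1,
          MonoidHom.id_comp, hqτ]
      · rw [hom_comp, hom_comp, MonoidHom.comp_assoc, ← MonoidHom.comp_assoc p.hom _ τ.hom, hτq,
          MonoidHom.id_comp, hp2]
      · rw [hom_comp, ← MonoidHom.comp_assoc,
          G.slideConj_hom_comp r δ c hδ hr f hf υ hυ hυr hυe, MonoidHom.comp_assoc, hfτ,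
          MonoidHom.comp_assoc]
      · rw [hom_comp, ← MonoidHom.comp_assoc,
          G.slideConj_hom_comp r δ c hδ hr g hg ν hν hνr hνe, MonoidHom.comp_assoc, hgτ,
          MonoidHom.comp_assoc]
      · intro i hi
        rcases eq_or_ne i r with rfl | hir
        · exact hn
        · have hlt : i < r := by
            refine lt_of_le_of_ne ?_ hir
            change i.val ≤ k
            omega
          refine (hnf i hlt).of_eqOn hf.1 hg.1 hf₂.1 hg₂.1
            (fun j hj => ⟨rfl, ?_⟩) (fun j hj => ?_) (fun j hj => ?_)
          · exact (G.slide_tgt_of_ne r c (ne_of_lt (hj.trans_lt hlt))).symm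
          · exact (G.slideConj_onEdge_of_lt r δ c hδ hr f hf υ hυ hυr (hj.trans_lt hlt)).symm
          · exact (G.slideConj_onEdge_of_lt r δ c hδ hr g hg ν hν hνr (hj.trans_lt hlt)).symm
    · refine ⟨G, f, g, τ, q, hf, hg, hτ, hτv, hqv, hqτ, hτq, hfτ, hgτ, fun i hi => ?_⟩
      rcases eq_or_ne i r with rfl | hir
      · exact fun h => absurd h hρ
      · refine hnf i ?_
        have : i.val ≠ k := fun h => hir (Fin.ext h)
        omega

theorem mainTheorem7 {V : Type u} {m : ℕ} (G' : FilteredGraph V m) (f' g' : GraphMap G' G')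
    (hf' : f'.IsUpperTriangular) (hg' : g'.IsUpperTriangular) :
    ∃ (G : FilteredGraph V m) (f g : GraphMap G G) (τ : GraphMap G' G),
      f.IsUpperTriangular ∧ g.IsUpperTriangular ∧
      τ.IsHomotopyEquiv ∧ IsSlideComposite G' G τ ∧
      (f.comp τ).FreelyHomotopic (τ.comp f') ∧ (g.comp τ).FreelyHomotopic (τ.comp g') ∧
      ∀ r : Fin m, (∃ ρ : EdgeSeq m, GraphMap.IsCommonNielsen f g ρ ∧ ρ.HasHeight r) →
        ∃ (rf rg : ℤ) (β : EdgeSeq m),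
          GraphMap.IsCommonNielsen f g β ∧ β.Below r ∧ G.IsPath (G.tgt r) β (G.tgt r) ∧
          f.onEdge r = (r, true) :: β.zpow rf ∧
          g.onEdge r = (r, true) :: β.zpow rg ∧
          (rf = 0 ∧ rg = 0 →
            GraphMap.IsCommonIndivisibleNielsen f g [(r, true)] ∧
            ∀ ρ : EdgeSeq m, GraphMap.IsCommonIndivisibleNielsen f g ρ → ρ.HasHeight r →
              ρ = [(r, true)] ∨ ρ = [(r, false)]) ∧
          (¬ (rf = 0 ∧ rg = 0) →
            GraphMap.IsCommonIndivisibleNielsen f g ((r, true) :: β ++ [(r, false)]) ∧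
            ∀ ρ : EdgeSeq m, GraphMap.IsCommonIndivisibleNielsen f g ρ → ρ.HasHeight r →
              ∃ k : ℤ, k ≠ 0 ∧ ρ = (r, true) :: β.zpow k ++ [(r, false)]) := by
  obtain ⟨G, f, g, τ, q, hf, hg, hτ, hτv, hqv, hqτ, hτq, hfτ, hgτ, hnf⟩ :=
    exists_slideComposite_hasNormalForm G' f' g' hf' hg' m le_rfl
  refine ⟨G, f, g, τ, hf, hg, ⟨q, ?_, ?_⟩, hτ, ?_, ?_, fun r => hnf r r.2⟩
  · refine GraphMap.freelyHomotopic_of_hom_eq (fun a => ?_) ?_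
    · change q.onVert (τ.onVert a) = a
      rw [hτv, hqv]
    · rw [GraphMap.hom_comp, hqτ, GraphMap.hom_id]
  · refine GraphMap.freelyHomotopic_of_hom_eq (fun a => ?_) ?_
    · change τ.onVert (q.onVert a) = a
      rw [hqv, hτv]
    · rw [GraphMap.hom_comp, hτq, GraphMap.hom_id]
  · refine GraphMap.freelyHomotopic_of_hom_eq (fun a => ?_) ?_
    · change f.onVert (τ.onVert a) = τ.onVert (f'.onVert a)
      rw [hf.1, hτv, hf'.1, hτv]
    · rw [GraphMap.hom_comp, GraphMap.hom_comp, hfτ]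
  · refine GraphMap.freelyHomotopic_of_hom_eq (fun a => ?_) ?_
    · change g.onVert (τ.onVert a) = τ.onVert (g'.onVert a)
      rw [hg.1, hτv, hg'.1, hτv]
    · rw [GraphMap.hom_comp, GraphMap.hom_comp, hgτ]
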